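/- A double Stone algebra is an algebra $\mathbf L=(L;\vee,\wedge,{}^\star,{}^+,0,1)$ such that $(L;\vee,\wedge,0,1)$ is a bounded distributive lattice, ${}^\star$ is pseudocomplementation and ${}^+$ is dual pseudocomplementation, and $x^\star\vee x^{\star\star}=1$, $x^+\wedge x^{++}=0$ hold identically. For $n\ge 2$ let $\mathbf n$ be the $n$-element chain with $0^\star=1$, $x^\star=0$ for $x\neq 0$, $1^+=0$, $x^+=1$ for $x\ne 1$. $\mathbb{ISP}(\mathbf M)$ is the class of isomorphic copies of subalgebras of powers of $\mathbf M$. A double Stone algebra is regular if it lies in $\mathbb{ISP}(\mathbf 3)$, and proper if it lies in $\mathbb{ISP}(\mathbf 4)\setminus\mathbb{ISP}(\mathbf 3)$. The core of $\mathbf L$ is $K(\mathbf L)=\{x\in L\mid x^\star=0,\ x^+=1\}$, a possibly empty sublattice. An algebra $\mathbf R$ is a retract of $\mathbf L$ if there are homomorphisms $i:\mathbf R\to\mathbf L$ and $p:\mathbf L\to\mathbf R$ with $p\circ i=\mathrm{id}$. For $k\ge1$, $\mathbf L$ is $k$-endoprimal if every function $L^k\to L$ that commutes with all endomorphisms of $\mathbf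 L$ is a term function of $\mathbf L$; it is endoprimal if it is $k$-endoprimal for all $k\ge 1$. A finite algebra $\mathbf L$ is endodualisable if $\mathrm{End}(\mathbf L)$ yields a duality on $\mathbb{ISP}(\mathbf L)$: for every $\mathbf A\in\mathbb{ISP}(\mathbf L)$, every continuous map $\mathrm{Hom}(\mathbf A,\mathbf L)\to L$ that preserves all endomorphisms of $\mathbf L$ is the evaluation $h\mapsto h(a)$ at exactly one $a\in A$, where $L$ is discrete and $\mathrm{Hom}(\mathbf A,\mathbf L)$ is a subspace of $L^A$. Let $\mathbf L$ be a finite double Stone algebra. (I) If $\mathbf L$ is proper and $K(\mathbf L)\neq\emptyset$, then the following are equivalent: (1) $\mathbf L$ is endodualisable; (2) $\mathbf L$ is endoprimal; (3) $\mathbf L$ is $3$-endoprimal; (4) $\mathbf 5$ is a retract of $\mathbf L$; (5) the lattice $K(\mathbf L)$ is not Boolean. (II) If $\mathbf L$ is proper and $K(\mathbf L)=\emptyset$, then the following are equivalent: (1) $\mathbf L$ is endodualisable; (2) $\mathbf L$ is endoprimal; (3) $\mathbf L$ is $3$-endoprimal; (4) $\mathbf 5\times\mathbf 2^2$ is a retract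 of $\mathbf L$. (III) If $\mathbf L$ is regular and not Boolean, then the following are equivalent: (1) $\mathbf L$ is endodualisable; (2) $\mathbf L$ is endoprimal; (3) $\mathbf L$ is $1$-endoprimal; (4) $\mathbf 3\times\mathbf 2^2$ is a retract of $\mathbf L$. (IV) $\mathbf L$ is endoprimal if and only if it is endodualisable. -/

import Mathlib

universe u v w

/-- A double Stone algebra `(L; ⊔, ⊓, star, plus, ⊥, ⊤)`: a bounded distributive lattice in which
`star x` is the pseudocomplement of `x`, `plus x` is the dual pseudocomplement of `x`, and the Stone
identity and its dual hold. -/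
class DoubleStoneAlgebra (α : Type u) extends DistribLattice α, BoundedOrder α where
  /-- the pseudocomplement -/
  star : α → α
  /-- the dual pseudocomplement -/
  plus : α → α
  le_star_iff : ∀ x y : α, y ≤ star x ↔ x ⊓ y = ⊥
  star_sup_star_star : ∀ x : α, star x ⊔ star (star x) = ⊤
  plus_le_iff : ∀ x y : α, plus x ≤ y ↔ x ⊔ y = ⊤
  plus_inf_plus_plus : ∀ x : α, plus x ⊓ plus (plus x) = ⊥

namespace DoubleStone

open DoubleStoneAlgebra

/-- Homomorphisms of double Stone algebras: maps preserving all the operations. -/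
structure DSHom (A : Type u) (B : Type v) [DoubleStoneAlgebra A] [DoubleStoneAlgebra B] where
  toFun : A → B
  map_sup' : ∀ x y, toFun (x ⊔ y) = toFun x ⊔ toFun y
  map_inf' : ∀ x y, toFun (x ⊓ y) = toFun x ⊓ toFun y
  map_star' : ∀ x, toFun (star x) = star (toFun x)
  map_plus' : ∀ x, toFun (plus x) = plus (toFun x)
  map_bot' : toFun ⊥ = ⊥
  map_top' : toFun ⊤ = ⊤

instance (A : Type u) (B : Type v) [DoubleStoneAlgebra A] [DoubleStoneAlgebra B] :
    FunLike (DSHom A B) A B where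
  coe := DSHom.toFun
  coe_injective f g h := by cases f; cases g; congr

/-- Composition of homomorphisms. -/
def DSHom.comp {A : Type u} {B : Type v} {C : Type w}
    [DoubleStoneAlgebra A] [DoubleStoneAlgebra B] [DoubleStoneAlgebra C]
    (g : DSHom B C) (f : DSHom A B) : DSHom A C where
  toFun x := g.toFun (f.toFun x)
  map_sup' x y := by rw [f.map_sup', g.map_sup']
  map_inf' x y := by rw [f.map_inf', g.map_inf']
  map_star' x := by rw [f.map_star', g.map_star']
  map_plus' x := by rw [f.map_plus', g.map_plus']
  map_bot' := by rw [f.map_bot', g.map_bot']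
  map_top' := by rw [f.map_top', g.map_top']

/-- Products of double Stone algebras, with the coordinatewise operations. -/
instance (I : Type v) (B : I → Type u) [∀ i, DoubleStoneAlgebra (B i)] :
    DoubleStoneAlgebra (∀ i, B i) where
  star x := fun i => star (x i)
  plus x := fun i => plus (x i)
  le_star_iff x y := by
    simp only [Pi.le_def, le_star_iff, funext_iff, Pi.inf_apply, Pi.bot_apply]
  star_sup_star_star x := by
    funext i
    exact star_sup_star_star (x i)
  plus_le_iff x y := by
    simp only [Pi.le_def, plus_le_iff, funext_iff, Pi.sup_apply, Pi.top_apply]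
  plus_inf_plus_plus x := by
    funext i
    exact plus_inf_plus_plus (x i)

/-- Binary products of double Stone algebras, with the coordinatewise operations. -/
instance (A : Type u) (B : Type v) [DoubleStoneAlgebra A] [DoubleStoneAlgebra B] :
    DoubleStoneAlgebra (A × B) where
  star x := (star x.1, star x.2)
  plus x := (plus x.1, plus x.2)
  le_star_iff x y := by
    simp only [Prod.le_def, le_star_iff, Prod.ext_iff, Prod.fst_inf, Prod.snd_inf, Prod.fst_bot,
      Prod.snd_bot]
  star_sup_star_star x := Prod.ext (star_sup_star_star x.1) (star_sup_star_star x.2)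
  plus_le_iff x y := by
    simp only [Prod.le_def, plus_le_iff, Prod.ext_iff, Prod.fst_sup, Prod.snd_sup, Prod.fst_top,
      Prod.snd_top]
  plus_inf_plus_plus x := Prod.ext (plus_inf_plus_plus x.1) (plus_inf_plus_plus x.2)

/-- The `(n + 2)`-element chain as a double Stone algebra. The algebras usually written
`𝟐`, `𝟑`, `𝟒`, `𝟓` are `Fin 2`, `Fin 3`, `Fin 4`, `Fin 5` with this structure. -/
instance (n : ℕ) : DoubleStoneAlgebra (Fin (n + 2)) where
  toDistribLattice := instDistribLatticeOfLinearOrder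
  toBoundedOrder := Fin.instBoundedOrder
  star x := if x = 0 then Fin.last (n + 1) else 0
  plus x := if x = Fin.last (n + 1) then 0 else Fin.last (n + 1)
  le_star_iff x y := by
    change y ≤ (if x = 0 then Fin.last (n + 1) else 0) ↔ min x y = 0
    by_cases h : x = 0
    · simp [h, Fin.le_last]
    · rw [if_neg h]
      grind
  star_sup_star_star x := by
    change max (if x = 0 then Fin.last (n + 1) else 0)
      (if (if x = 0 then Fin.last (n + 1) else 0) = 0 then Fin.last (n + 1) else 0) =
        Fin.last (n + 1)
    by_cases h : x = 0 <;> simp [h]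
  plus_le_iff x y := by
    change (if x = Fin.last (n + 1) then 0 else Fin.last (n + 1)) ≤ y ↔ max x y = Fin.last (n + 1)
    by_cases h : x = Fin.last (n + 1)
    · simp [h, Fin.le_last]
    · rw [if_neg h]
      have hx := Fin.le_last x
      have hy := Fin.le_last y
      grind
  plus_inf_plus_plus x := by
    change min (if x = Fin.last (n + 1) then 0 else Fin.last (n + 1))
      (if (if x = Fin.last (n + 1) then 0 else Fin.last (n + 1)) = Fin.last (n + 1) then 0
        else Fin.last (n + 1)) = 0
    by_cases h : x = Fin.last (n + 1) <;> simp [h]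

/-- `A ∈ ISP(M)`: `A` is isomorphic to a subalgebra of a power of `M`. -/
def MemISP (M : Type u) [DoubleStoneAlgebra M] (A : Type v) [DoubleStoneAlgebra A] : Prop :=
  ∃ (I : Type (max u v)) (f : DSHom A (I → M)), Function.Injective f

/-- `R` is a retract of `L`. -/
def IsRetractOf (R : Type v) [DoubleStoneAlgebra R] (L : Type u) [DoubleStoneAlgebra L] : Prop :=
  ∃ (i : DSHom R L) (p : DSHom L R), ∀ x, p (i x) = x

/-- Regular double Stone algebras: the members of `ISP(𝟑)`. -/
def IsRegular (L : Type u) [DoubleStoneAlgebra L] : Prop := MemISP (Fin 3) L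

/-- Proper double Stone algebras: the members of `ISP(𝟒)` that do not belong to `ISP(𝟑)`. -/
def IsProper (L : Type u) [DoubleStoneAlgebra L] : Prop :=
  MemISP (Fin 4) L ∧ ¬ MemISP (Fin 3) L

/-- The core of `L`, a (possibly empty) sublattice of `L`. -/
def core (L : Type u) [DoubleStoneAlgebra L] : Sublattice L where
  carrier := {x | star x = ⊥ ∧ plus x = ⊤}
  supClosed' := by
    rintro x ⟨hx, hx'⟩ y ⟨-, hy'⟩
    constructor
    · have h := (le_star_iff (x ⊔ y) (star (x ⊔ y))).1 le_rfl
      rw [eq_bot_iff, ← hx, le_star_iff, eq_bot_iff, ← h]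
      exact inf_le_inf_right _ le_sup_left
    · have h := (plus_le_iff (x ⊔ y) (plus (x ⊔ y))).1 le_rfl
      rw [sup_assoc, ← plus_le_iff, hx', top_le_iff, ← plus_le_iff, hy', top_le_iff] at h
      exact h
  infClosed' := by
    rintro x ⟨hx, hx'⟩ y ⟨hy, -⟩
    constructor
    · have h := (le_star_iff (x ⊓ y) (star (x ⊓ y))).1 le_rfl
      rw [inf_assoc, ← le_star_iff, hx, le_bot_iff, ← le_star_iff, hy, le_bot_iff] at h
      exact h
    · have h := (plus_le_iff (x ⊓ y) (plus (x ⊓ y))).1 le_rfl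
      rw [eq_top_iff, ← hx', plus_le_iff, eq_top_iff, ← h]
      exact sup_le_sup_right inf_le_left _

/-- A distributive lattice is Boolean if it is bounded and every element has a complement. -/
def IsBooleanLattice (α : Type u) [DistribLattice α] : Prop :=
  ∃ b t : α, IsBot b ∧ IsTop t ∧ ∀ x : α, ∃ y : α, x ⊓ y = b ∧ x ⊔ y = t

/-- Terms of double Stone algebras in `k` variables. -/
inductive DSTerm (k : ℕ) : Type
  | var : Fin k → DSTerm k
  | bot : DSTerm k
  | top : DSTerm k
  | sup : DSTerm k → DSTerm k → DSTerm k
  | inf : DSTerm k → DSTerm k → DSTerm k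
  | star : DSTerm k → DSTerm k
  | plus : DSTerm k → DSTerm k

/-- The term function on `L` of a term. -/
def DSTerm.eval {k : ℕ} {L : Type u} [DoubleStoneAlgebra L] (x : Fin k → L) : DSTerm k → L
  | .var i => x i
  | .bot => ⊥
  | .top => ⊤
  | .sup s t => s.eval x ⊔ t.eval x
  | .inf s t => s.eval x ⊓ t.eval x
  | .star t => DoubleStoneAlgebra.star (t.eval x)
  | .plus t => DoubleStoneAlgebra.plus (t.eval x)

/-- `L` is `k`-endoprimal: every `k`-ary function on `L` that preserves (the graphs of) all the
endomorphisms of `L` is a term function. -/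
def KEndoprimal (k : ℕ) (L : Type u) [DoubleStoneAlgebra L] : Prop :=
  ∀ F : (Fin k → L) → L,
    (∀ (e : DSHom L L) (x : Fin k → L), F (fun i => e (x i)) = e (F x)) →
      ∃ t : DSTerm k, ∀ x, F x = t.eval x

/-- `L` is endoprimal: it is `k`-endoprimal for every `k ≥ 1`. -/
def Endoprimal (L : Type u) [DoubleStoneAlgebra L] : Prop :=
  ∀ k : ℕ, 1 ≤ k → KEndoprimal k L

/-- The topology on the dual `D(A) = Hom(A, L)`, as a subspace of the power `L ^ A` of the
discrete space `L`. -/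
@[reducible] def dualTopology (A : Type v) (L : Type u) [DoubleStoneAlgebra A] [DoubleStoneAlgebra L] :
    TopologicalSpace (DSHom A L) :=
  TopologicalSpace.induced (fun h : DSHom A L => (h : A → L))
    (@Pi.topologicalSpace A (fun _ => L) (fun _ => ⊥))

/-- `φ : D(A) → L` is a morphism of structures with respect to `End(L)`: it is continuous
(`L` being discrete) and preserves every endomorphism of `L`, which acts on `D(A)` by composition. -/
def IsDualMorphism {A : Type v} {L : Type u} [DoubleStoneAlgebra A] [DoubleStoneAlgebra L]
    (φ : DSHom A L → L) : Prop :=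
  @Continuous _ _ (dualTopology A L) ⊥ φ ∧
    ∀ (e : DSHom L L) (h : DSHom A L), φ (e.comp h) = e (φ h)

/-- `L` is endodualisable: `End(L)` yields a duality on `ISP(L)`, that is, for every `A ∈ ISP(L)`,
every morphism `D(A) → L` is evaluation at exactly one element of `A`. (Every algebra of the
similarity type that lies in `ISP(L)` is a double Stone algebra.) -/
def Endodualisable (L : Type u) [DoubleStoneAlgebra L] : Prop :=
  ∀ (A : Type v) [DoubleStoneAlgebra A], MemISP L A →
    ∀ φ : DSHom A L → L, IsDualMorphism φ → ∃! a : A, ∀ h : DSHom A L, φ h = h a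

end DoubleStone

/-!
Every double Stone algebra is separated by its homomorphisms to the five-element chain
(`eq_of_forall_hom_eq`): a prime filter `P` yields the chain of prime filters
`{x | x⋆⋆ ∈ P} ⊇ P ⊇ {x | x⁺⁺ ∈ P}`, and more generally prime filters `P ⊆ Q` yield a homomorphism
(`exists_hom_five`). So identities and order relations may be checked in that chain.

*Retracts give dualities.* If homomorphisms from `L` to a chain `R` separate points, a continuous
map `φ : Hom(A, L) → L` is evaluation at an element of `A` as soon as it respects the inclusions
between the prime filters of `A` obtained by composing with homomorphisms `L → R`
(`exists_forall_eq_eval`, a compactness argument). If `R` is a retract of `L`, then `φ` is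
determined by a map `ψ : Hom(A, R) → R` that commutes with `End(R)`, and the inclusions need to be
checked for `ψ` only. For `R = 𝟓` they are respected because comparable prime filters are the
inverse images of `{3, 4}` and `{2, 3, 4}` under one homomorphism, and endomorphisms of `𝟓` move the
remaining thresholds to these two (`compatible_five`). For `R = 𝟑` they are respected if `ψ` is
two-valued on two-valued homomorphisms (`compatible_three`). If `R × 𝟐²` is a retract, `ψ` is again
well defined, since endomorphisms can copy either component in `𝟐` to the other one, and it has the
additional property (`endodualisable_of_isRetractOf_prod`).

*Endodualisable algebras are endoprimal*, by duality for the algebra of `k`-ary term functions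
(`Endodualisable.kEndoprimal`).

*Endoprimal algebras have the retracts.* Let `support x = x⋆⋆ ⊓ x⁺`, and let `e` be the largest
value of `support`; it is complemented, so that `L` is the product of `[⊥, e]`, which has a nonempty
core, and of the Boolean algebra `[⊥, star e]`. The core of `L` is nonempty if and only if `e = ⊤`.
Three kinds of operations commute with all endomorphisms without being term functions:
a relative complementation on the core of `[⊥, e]` if that core is Boolean with more than one
element (`not_kEndoprimal_three`), a unary operation depending on the Boolean component if
`[⊥, star e]` has exactly two elements and `e ≠ ⊥` (`not_kEndoprimal_of_atom`), and the constant
operation on a one-element core (`not_kEndoprimal_of_core_subsingleton`). If they are excluded, the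
core of `[⊥, e]` has an element without complement unless `L` is regular, which provides a
five-element chain and comparable prime filters retracting onto it
(`exists_hom_five_of_not_complemented`), and `[⊥, star e]` is trivial or splits
(`exists_split_of_kEndoprimal`).
-/

namespace DoubleStone

open DoubleStoneAlgebra

/-! ### Identities and homomorphisms -/

section Identities

variable {A : Type u} [DoubleStoneAlgebra A]

theorem inf_star_self (x : A) : x ⊓ star x = ⊥ := (le_star_iff _ _).1 le_rfl

theorem sup_plus_self (x : A) : x ⊔ plus x = ⊤ := (plus_le_iff _ _).1 le_rfl

theorem le_star_star (x : A) : x ≤ star (star x) := by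
  rw [le_star_iff, inf_comm, inf_star_self]

theorem plus_plus_le (x : A) : plus (plus x) ≤ x := by
  rw [plus_le_iff, sup_comm, sup_plus_self]

theorem isCompl_star (x : A) : IsCompl (star x) (star (star x)) :=
  IsCompl.of_eq (inf_star_self _) (star_sup_star_star x)

theorem isCompl_plus (x : A) : IsCompl (plus x) (plus (plus x)) :=
  IsCompl.of_eq (plus_inf_plus_plus x) (sup_plus_self _)

theorem star_eq_of_isCompl {x y : A} (h : IsCompl x y) : star x = y :=
  le_antisymm (h.symm.le_left_iff.2 (disjoint_iff.2 (by rw [inf_comm, inf_star_self])))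
    ((le_star_iff _ _).2 h.inf_eq_bot)

theorem plus_eq_of_isCompl {x y : A} (h : IsCompl x y) : plus x = y :=
  le_antisymm ((plus_le_iff _ _).2 h.sup_eq_top)
    (h.symm.left_le_iff.2 (codisjoint_iff.2 (by rw [sup_comm, sup_plus_self])))

theorem star_sup (x y : A) : star (x ⊔ y) = star x ⊓ star y := by
  refine eq_of_forall_le_iff fun z => ?_
  rw [le_inf_iff, le_star_iff, le_star_iff, le_star_iff, inf_sup_right, sup_eq_bot_iff]

theorem plus_inf (x y : A) : plus (x ⊓ y) = plus x ⊔ plus y := by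
  refine eq_of_forall_ge_iff fun z => ?_
  rw [sup_le_iff, plus_le_iff, plus_le_iff, plus_le_iff, sup_inf_right, inf_eq_top_iff]

theorem star_star_star (x : A) : star (star (star x)) = star x :=
  star_eq_of_isCompl (isCompl_star x).symm

theorem plus_plus_plus (x : A) : plus (plus (plus x)) = plus x :=
  plus_eq_of_isCompl (isCompl_plus x).symm

theorem star_star_sup (x y : A) : star (star (x ⊔ y)) = star (star x) ⊔ star (star y) := by
  rw [star_sup]
  exact star_eq_of_isCompl ((isCompl_star x).inf_sup (isCompl_star y))

theorem plus_plus_inf (x y : A) : plus (plus (x ⊓ y)) = plus (plus x) ⊓ plus (plus y) := by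
  rw [plus_inf]
  exact plus_eq_of_isCompl ((isCompl_plus x).sup_inf (isCompl_plus y))

theorem star_star_inf (x y : A) : star (star (x ⊓ y)) = star (star x) ⊓ star (star y) := by
  refine le_antisymm (le_inf ?_ ?_) ?_
  · rw [← sup_eq_right, ← star_star_sup, sup_eq_right.2 inf_le_left]
  · rw [← sup_eq_right, ← star_star_sup, sup_eq_right.2 inf_le_right]
  · have h : ∀ u z : A, star (star u) ⊓ z = ⊥ ↔ u ⊓ z = ⊥ := fun u z => by
      rw [← le_star_iff, ← le_star_iff, star_star_star]
    rw [le_star_iff, inf_left_comm, h, inf_comm (DoubleStoneAlgebra.star _), inf_left_comm x, h,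
      ← inf_assoc, inf_comm y, inf_star_self]

theorem plus_plus_sup (x y : A) : plus (plus (x ⊔ y)) = plus (plus x) ⊔ plus (plus y) := by
  refine le_antisymm ?_ (sup_le ?_ ?_)
  · have h : ∀ u z : A, plus (plus u) ⊔ z = ⊤ ↔ u ⊔ z = ⊤ := fun u z => by
      rw [← plus_le_iff, ← plus_le_iff, plus_plus_plus]
    rw [plus_le_iff, sup_left_comm, h, sup_comm (plus _), sup_left_comm x, h, ← sup_assoc,
      sup_comm y, sup_plus_self]
  · rw [← inf_eq_left, ← plus_plus_inf, inf_eq_left.2 le_sup_left]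
  · rw [← inf_eq_left, ← plus_plus_inf, inf_eq_left.2 le_sup_right]

theorem star_bot : star (⊥ : A) = ⊤ := star_eq_of_isCompl isCompl_bot_top
theorem star_top : star (⊤ : A) = ⊥ := star_eq_of_isCompl isCompl_top_bot
theorem plus_bot : plus (⊥ : A) = ⊤ := plus_eq_of_isCompl isCompl_bot_top
theorem plus_top : plus (⊤ : A) = ⊥ := plus_eq_of_isCompl isCompl_top_bot

end Identities

section Hom

variable {A : Type u} {B : Type v} [DoubleStoneAlgebra A] [DoubleStoneAlgebra B]

theorem map_sup (f : DSHom A B) (x y : A) : f (x ⊔ y) = f x ⊔ f y := f.map_sup' x y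
theorem map_inf (f : DSHom A B) (x y : A) : f (x ⊓ y) = f x ⊓ f y := f.map_inf' x y
theorem map_star (f : DSHom A B) (x : A) : f (star x) = star (f x) := f.map_star' x
theorem map_plus (f : DSHom A B) (x : A) : f (plus x) = plus (f x) := f.map_plus' x
theorem map_bot (f : DSHom A B) : f ⊥ = ⊥ := f.map_bot'
theorem map_top (f : DSHom A B) : f ⊤ = ⊤ := f.map_top'

theorem map_mono (f : DSHom A B) {x y : A} (h : x ≤ y) : f x ≤ f y := by
  rw [← inf_eq_left] at h ⊢
  rw [← map_inf, h]

theorem comp_apply {C : Type w} [DoubleStoneAlgebra C] (g : DSHom B C) (f : DSHom A B) (x : A) :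
    g.comp f x = g (f x) := rfl

theorem hom_ext {f g : DSHom A B} (h : ∀ x, f x = g x) : f = g := DFunLike.ext _ _ h

/-- The projection of a binary product to its first factor. -/
def fstHom (A : Type u) (B : Type v) [DoubleStoneAlgebra A] [DoubleStoneAlgebra B] :
    DSHom (A × B) A :=
  ⟨Prod.fst, fun _ _ => rfl, fun _ _ => rfl, fun _ => rfl, fun _ => rfl, rfl, rfl⟩

/-- The projection of a binary product to its second factor. -/
def sndHom (A : Type u) (B : Type v) [DoubleStoneAlgebra A] [DoubleStoneAlgebra B] :
    DSHom (A × B) B :=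
  ⟨Prod.snd, fun _ _ => rfl, fun _ _ => rfl, fun _ => rfl, fun _ => rfl, rfl, rfl⟩

/-- The homomorphism into a binary product with given components. -/
def pairHom {C : Type w} [DoubleStoneAlgebra C] (f : DSHom C A) (g : DSHom C B) :
    DSHom C (A × B) where
  toFun x := (f x, g x)
  map_sup' x y := by rw [map_sup, map_sup]; rfl
  map_inf' x y := by rw [map_inf, map_inf]; rfl
  map_star' x := by rw [map_star, map_star]; rfl
  map_plus' x := by rw [map_plus, map_plus]; rfl
  map_bot' := by rw [map_bot, map_bot]; rfl
  map_top' := by rw [map_top, map_top]; rfl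

instance [Finite A] [Finite B] : Finite (DSHom A B) := Finite.of_injective _ DFunLike.coe_injective

/-- `A ∈ ISP(M)` means that the homomorphisms `A → M` separate the elements of `A`. -/
theorem memISP_iff {M : Type u} [DoubleStoneAlgebra M] {A : Type v} [DoubleStoneAlgebra A] :
    MemISP M A ↔ ∀ x y : A, (∀ q : DSHom A M, q x = q y) → x = y := by
  constructor
  · rintro ⟨I, f, hf⟩ x y h
    refine hf (funext fun i => ?_)
    exact h ⟨fun z => f z i, fun a b => congrFun (map_sup f a b) i,
      fun a b => congrFun (map_inf f a b) i, fun a => congrFun (map_star f a) i,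
      fun a => congrFun (map_plus f a) i, congrFun (map_bot f) i, congrFun (map_top f) i⟩
  · intro h
    refine ⟨DSHom A M, ⟨fun x q => q x, ?_, ?_, ?_, ?_, ?_, ?_⟩, fun x y hxy =>
      h x y fun q => congrFun hxy q⟩
    · exact fun x y => funext fun q => map_sup q x y
    · exact fun x y => funext fun q => map_inf q x y
    · exact fun x => funext fun q => map_star q x
    · exact fun x => funext fun q => map_plus q x
    · exact funext fun q => map_bot q
    · exact funext fun q => map_top q

end Hom

/-! ### Homomorphisms from and to chains -/

section Chain

variable {n : ℕ}

theorem fin_bot : (⊥ : Fin (n + 2)) = 0 := rfl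
theorem fin_top : (⊤ : Fin (n + 2)) = Fin.last (n + 1) := rfl
theorem fin_star (x : Fin (n + 2)) : star x = if x = ⊥ then ⊤ else ⊥ := rfl
theorem fin_plus (x : Fin (n + 2)) : plus x = if x = ⊤ then ⊥ else ⊤ := rfl
theorem fin_le_sup (s x y : Fin (n + 2)) : s ≤ x ⊔ y ↔ s ≤ x ∨ s ≤ y := le_max_iff

theorem fin_bot_ne_top : (⊥ : Fin (n + 2)) ≠ ⊤ := by
  intro h
  exact absurd (congrArg Fin.val h) (by simp [fin_bot, fin_top])

theorem fin_eq_of_forall_le_iff {x y : Fin (n + 2)} (h : ∀ s, s ≠ ⊥ → (s ≤ x ↔ s ≤ y)) :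
    x = y := by
  refine eq_of_forall_le_iff fun s => ?_
  by_cases hs : s = ⊥
  · subst hs
    exact iff_of_true bot_le bot_le
  · exact h s hs

variable {A : Type u} [DoubleStoneAlgebra A]

/-- The characteristic predicates of the prime filters of `A`. -/
structure IsPrimePred (P : A → Prop) : Prop where
  top : P ⊤
  bot : ¬ P ⊥
  inf : ∀ x y, P (x ⊓ y) ↔ P x ∧ P y
  sup : ∀ x y, P (x ⊔ y) ↔ P x ∨ P y

theorem IsPrimePred.mono {P : A → Prop} (hP : IsPrimePred P) {x y : A} (h : x ≤ y) (hx : P x) :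
    P y := by
  rw [← inf_eq_left.2 h, hP.inf] at hx
  exact hx.2

theorem IsPrimePred.isCompl_iff {P : A → Prop} (hP : IsPrimePred P) {x y : A} (h : IsCompl x y) :
    P x ↔ ¬ P y := by
  have h₁ := hP.top
  have h₂ := hP.bot
  rw [← h.sup_eq_top, hP.sup] at h₁
  rw [← h.inf_eq_bot, hP.inf] at h₂
  tauto

theorem isPrimePred_le {s : Fin (n + 2)} (hs : s ≠ ⊥) :
    IsPrimePred (fun x : Fin (n + 2) => s ≤ x) :=
  ⟨le_top, fun h => hs (le_bot_iff.1 h), fun _ _ => le_inf_iff, fin_le_sup s⟩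

theorem IsPrimePred.comp {B : Type v} [DoubleStoneAlgebra B] {P : B → Prop} (hP : IsPrimePred P)
    (f : DSHom A B) : IsPrimePred (fun x => P (f x)) :=
  ⟨by rw [map_top]; exact hP.top, by rw [map_bot]; exact hP.bot,
    fun x y => by rw [map_inf, hP.inf], fun x y => by rw [map_sup, hP.sup]⟩

/-- A prime filter `P` can be enlarged to a prime filter containing `a` and avoiding `b` unless
`p ⊓ a ≤ b` for some `p ∈ P`. This only uses that `P` contains `⊤` and is closed under meets. -/
theorem exists_isPrimePred (P : A → Prop) (h_top : P ⊤) (h_inf : ∀ x y, P x → P y → P (x ⊓ y))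
    (a b : A) (h : ∀ p, P p → ¬ p ⊓ a ≤ b) :
    ∃ Q : A → Prop, IsPrimePred Q ∧ (∀ x, P x → Q x) ∧ Q a ∧ ¬ Q b := by
  have hF : Order.IsPFilter {x : A | ∃ p, P p ∧ p ⊓ a ≤ x} := by
    refine Order.IsPFilter.of_def ⟨⊤, ⊤, h_top, le_top⟩ ?_ ?_
    · rintro x ⟨p, hp, hx⟩ y ⟨q, hq, hy⟩
      exact ⟨x ⊓ y, ⟨p ⊓ q, h_inf _ _ hp hq,
        le_inf ((inf_le_inf_right _ inf_le_left).trans hx)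
          ((inf_le_inf_right _ inf_le_right).trans hy)⟩, inf_le_left, inf_le_right⟩
    · rintro x y hxy ⟨p, hp, hx⟩
      exact ⟨p, hp, hx.trans hxy⟩
  obtain ⟨J, hJ, hIJ, hFJ⟩ := DistribLattice.prime_ideal_of_disjoint_filter_ideal
    (F := hF.toPFilter) (I := Order.Ideal.principal b) (by
      rw [Set.disjoint_left]
      rintro x ⟨p, hp, hx⟩ hxb
      exact h p hp (hx.trans hxb))
  rw [Set.disjoint_left] at hFJ
  have hJ_mem : ∀ {x y}, P x → x ⊓ a ≤ y → y ∉ J := fun hp hle => hFJ ⟨_, hp, hle⟩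
  refine ⟨fun x => x ∉ J, ⟨hJ_mem h_top le_top, fun h => h J.bot_mem, fun x y => ?_, fun x y => ?_⟩,
    fun x hx => hJ_mem hx inf_le_left, hJ_mem h_top inf_le_right,
    fun h => h (hIJ (Order.Ideal.mem_principal.2 le_rfl))⟩
  · rw [← not_or, not_iff_not]
    exact ⟨fun hxy => hJ.mem_or_mem hxy, fun hxy => hxy.elim (J.lower inf_le_left)
      (J.lower inf_le_right)⟩
  · rw [← not_and_or, not_iff_not]
    exact Order.Ideal.sup_mem_iff

theorem exists_isPrimePred_of_not_le {a b : A} (h : ¬ a ≤ b) :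
    ∃ P : A → Prop, IsPrimePred P ∧ P a ∧ ¬ P b := by
  obtain ⟨Q, hQ, -, ha, hb⟩ := exists_isPrimePred (fun x : A => x = ⊤) rfl
    (by rintro _ _ rfl rfl; exact inf_idem _) a b
    (by rintro _ rfl h'; exact h (by rwa [top_inf_eq] at h'))
  exact ⟨Q, hQ, ha, hb⟩

open Classical in
/-- The largest element `s` of the chain with `P s x`, and `⊥` if there is none. -/
noncomputable def level {A : Type u} (P : Fin (n + 2) → A → Prop) (x : A) : Fin (n + 2) :=
  (Finset.univ.filter fun s => P s x).sup id

open Classical in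
theorem le_level_iff {A : Type u} {P : Fin (n + 2) → A → Prop}
    (h_anti : ∀ s r x, s ≠ ⊥ → s ≤ r → P r x → P s x) {s : Fin (n + 2)} (hs : s ≠ ⊥) (x : A) :
    s ≤ level P x ↔ P s x := by
  rw [level, Finset.le_sup_iff (bot_lt_iff_ne_bot.2 hs)]
  constructor
  · rintro ⟨r, hr, hsr⟩
    exact h_anti s r x hs hsr (Finset.mem_filter.1 hr).2
  · intro h
    exact ⟨s, Finset.mem_filter.2 ⟨Finset.mem_univ _, h⟩, le_rfl⟩

/-- A decreasing family of prime filters, one for each nonzero element of a chain, is the family of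
inverse images of the principal filters under a homomorphism to the chain, as soon as the smallest
and the largest member of the family are compatible with the two pseudocomplementations. -/
theorem exists_hom_of_isPrimePred (P : Fin (n + 2) → A → Prop) (hP : ∀ s, s ≠ ⊥ → IsPrimePred (P s))
    (h_anti : ∀ s r x, s ≠ ⊥ → s ≤ r → P r x → P s x)
    (h_star : ∀ s x, s ≠ ⊥ → (P s (star x) ↔ ∀ r, r ≠ ⊥ → ¬ P r x))
    (h_plus : ∀ s x, s ≠ ⊥ → (P s (plus x) ↔ ¬ P ⊤ x)) :
    ∃ q : DSHom A (Fin (n + 2)), ∀ s x, s ≠ ⊥ → (s ≤ q x ↔ P s x) := by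
  have key := fun s hs x => le_level_iff h_anti (s := s) hs x
  refine ⟨⟨level P, fun x y => ?_, fun x y => ?_, fun x => ?_, fun x => ?_, ?_, ?_⟩,
    fun s x hs => key s hs x⟩
  all_goals refine fin_eq_of_forall_le_iff fun s hs => ?_
  · rw [key s hs, (hP s hs).sup, fin_le_sup, key s hs, key s hs]
  · rw [key s hs, (hP s hs).inf, le_inf_iff, key s hs, key s hs]
  · rw [key s hs, h_star s x hs, fin_star]
    split_ifs with h
    · refine iff_of_true (fun r hr hx => ?_) le_top
      rw [← key r hr, h, le_bot_iff] at hx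
      exact hr hx
    · refine iff_of_false (fun hx => hx _ h ?_) fun h' => hs (le_bot_iff.1 h')
      rw [← key _ h]
  · rw [key s hs, h_plus s x hs, fin_plus, ← key ⊤ fin_bot_ne_top.symm, top_le_iff]
    split_ifs with h
    · exact iff_of_false (fun h' => h' h) fun h' => hs (le_bot_iff.1 h')
    · exact iff_of_true h le_top
  · rw [key s hs]
    exact iff_of_false (hP s hs).bot fun h' => hs (le_bot_iff.1 h')
  · rw [key s hs]
    exact iff_of_true (hP s hs).top le_top

/-- Prime filters `P ⊆ Q` give a homomorphism to the five-element chain in which `Q` and `P` are the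
inverse images of `{2, 3, 4}` and `{3, 4}`. The inverse images of `{1, 2, 3, 4}` and `{4}` are the
largest and the smallest prime filter comparable with `P`. -/
theorem exists_hom_five {P Q : A → Prop} (hP : IsPrimePred P) (hQ : IsPrimePred Q)
    (hPQ : ∀ x, P x → Q x) :
    ∃ q : DSHom A (Fin 5), ∀ x, (2 ≤ q x ↔ Q x) ∧ (3 ≤ q x ↔ P x) := by
  have hstar : ∀ x, P (star x) ↔ Q (star x) := fun x => by
    have h₁ := hP.isCompl_iff (isCompl_star x)
    have h₂ := hQ.isCompl_iff (isCompl_star x)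
    have h₃ := hPQ (star x)
    have h₄ := hPQ (star (star x))
    tauto
  have hplus : ∀ x, P (plus x) ↔ Q (plus x) := fun x => by
    have h₁ := hP.isCompl_iff (isCompl_plus x)
    have h₂ := hQ.isCompl_iff (isCompl_plus x)
    have h₃ := hPQ (plus x)
    have h₄ := hPQ (plus (plus x))
    tauto
  have h12 : ∀ x, Q x → Q (star (star x)) := fun x => hQ.mono (le_star_star x)
  have h34 : ∀ x, P (plus (plus x)) → P x := fun x => hP.mono (plus_plus_le x)
  have hQ₁ : IsPrimePred fun x => Q (star (star x)) :=
    ⟨hQ.mono (le_star_star _) hQ.top, by rw [star_bot, star_top]; exact hQ.bot,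
      fun x y => by rw [star_star_inf, hQ.inf], fun x y => by rw [star_star_sup, hQ.sup]⟩
  have hP₄ : IsPrimePred fun x => P (plus (plus x)) :=
    ⟨by rw [plus_top, plus_bot]; exact hP.top, fun h => hP.bot (h34 _ h),
      fun x y => by rw [plus_plus_inf, hP.inf], fun x y => by rw [plus_plus_sup, hP.sup]⟩
  suffices h : ∃ q : DSHom A (Fin 5), ∀ s x, s ≠ ⊥ → (s ≤ q x ↔
      if s = 1 then Q (star (star x)) else if s = 2 then Q x else
        if s = 3 then P x else P (plus (plus x))) by
    obtain ⟨q, hq⟩ := h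
    exact ⟨q, fun x => ⟨hq 2 x (by decide), hq 3 x (by decide)⟩⟩
  refine exists_hom_of_isPrimePred _ ?_ ?_ ?_ ?_
  · intro s hs
    fin_cases s
    exacts [absurd rfl hs, hQ₁, hQ, hP, hP₄]
  · intro s r x hs hsr
    have h₁ := h12 x
    have h₂ := hPQ x
    have h₃ := h34 x
    fin_cases s <;> fin_cases r <;>
      first | exact absurd rfl hs | exact absurd hsr (by decide) | (simp <;> tauto)
  · intro s x hs
    have h₁ := h12 x
    have h₂ := hPQ x
    have h₃ := h34 x
    have h₅ := hQ.isCompl_iff (isCompl_star x)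
    have h₆ := hstar x
    have h₇ : plus (plus (star x)) = star x := by
      rw [plus_eq_of_isCompl (isCompl_star x), plus_eq_of_isCompl (isCompl_star x).symm]
    trans Q (star x)
    · fin_cases s
      exacts [absurd rfl hs, by simp [star_star_star], by simp, by simpa using h₆,
        by simpa [h₇] using h₆]
    · rw [h₅]
      refine ⟨fun h r hr => ?_, fun h => by simpa using h 1 (by decide)⟩
      fin_cases r <;> first | exact absurd rfl hr | (simp; tauto)
  · intro s x hs
    have h₅ := hP.isCompl_iff (isCompl_plus x)
    have h₆ := hplus x
    have h₇ : star (star (plus x)) = plus x := by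
      rw [star_eq_of_isCompl (isCompl_plus x), star_eq_of_isCompl (isCompl_plus x).symm]
    trans P (plus x)
    · fin_cases s
      exacts [absurd rfl hs, by simpa [h₇] using h₆.symm, by simpa using h₆.symm, by simp,
        by simp [plus_plus_plus]]
    · rw [h₅]
      simp [fin_top]

/-- The homomorphisms to the five-element chain recognise the order. -/
theorem le_of_forall_hom_le {x y : A} (h : ∀ q : DSHom A (Fin 5), q x ≤ q y) : x ≤ y := by
  by_contra hxy
  obtain ⟨P, hP, hx, hy⟩ := exists_isPrimePred_of_not_le hxy
  obtain ⟨q, hq⟩ := exists_hom_five hP hP fun _ => id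
  exact hy ((hq y).1.1 (((hq x).1.2 hx).trans (h q)))

theorem eq_of_forall_hom_eq {x y : A} (h : ∀ q : DSHom A (Fin 5), q x = q y) : x = y :=
  le_antisymm (le_of_forall_hom_le fun q => (h q).le) (le_of_forall_hom_le fun q => (h q).ge)

/-- A map is a homomorphism if its composites with all homomorphisms to the five-element chain
are. -/
def homOfSeparated {B : Type v} [DoubleStoneAlgebra B] (f : A → B)
    (h : ∀ g : DSHom B (Fin 5), ∃ k : DSHom A (Fin 5), ∀ x, g (f x) = k x) : DSHom A B where
  toFun := f
  map_sup' x y := eq_of_forall_hom_eq fun g => by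
    obtain ⟨k, hk⟩ := h g
    rw [map_sup, hk, hk, hk, map_sup]
  map_inf' x y := eq_of_forall_hom_eq fun g => by
    obtain ⟨k, hk⟩ := h g
    rw [map_inf, hk, hk, hk, map_inf]
  map_star' x := eq_of_forall_hom_eq fun g => by
    obtain ⟨k, hk⟩ := h g
    rw [map_star, hk, hk, map_star]
  map_plus' x := eq_of_forall_hom_eq fun g => by
    obtain ⟨k, hk⟩ := h g
    rw [map_plus, hk, hk, map_plus]
  map_bot' := eq_of_forall_hom_eq fun g => by
    obtain ⟨k, hk⟩ := h g
    rw [hk, map_bot, map_bot]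
  map_top' := eq_of_forall_hom_eq fun g => by
    obtain ⟨k, hk⟩ := h g
    rw [hk, map_top, map_top]

/-- A monotone map from a chain that preserves the bounds and sends every other element into the
core, as a homomorphism. -/
def chainHom (C : Fin (n + 2) → A) (h_mono : Monotone C) (h_bot : C ⊥ = ⊥) (h_top : C ⊤ = ⊤)
    (h_core : ∀ s, s ≠ ⊥ → s ≠ ⊤ → C s ∈ core A) : DSHom (Fin (n + 2)) A where
  toFun := C
  map_sup' x y := h_mono.map_sup x y
  map_inf' x y := h_mono.map_inf x y
  map_star' x := by
    rw [fin_star]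
    by_cases h₀ : x = ⊥
    · rw [if_pos h₀, h₀, h_bot, h_top, star_bot]
    · rw [if_neg h₀, h_bot]
      by_cases h₁ : x = ⊤
      · rw [h₁, h_top, star_top]
      · exact (h_core x h₀ h₁).1.symm
  map_plus' x := by
    rw [fin_plus]
    by_cases h₁ : x = ⊤
    · rw [if_pos h₁, h₁, h_bot, h_top, plus_top]
    · rw [if_neg h₁, h_top]
      by_cases h₀ : x = ⊥
      · rw [h₀, h_bot, plus_bot]
      · exact (h_core x h₀ h₁).2.symm
  map_bot' := h_bot
  map_top' := h_top

theorem mem_core_iff {x : A} : x ∈ core A ↔ star x = ⊥ ∧ plus x = ⊤ := Iff.rfl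

theorem map_mem_core {B : Type v} [DoubleStoneAlgebra B] (f : DSHom A B) {x : A} (h : x ∈ core A) :
    f x ∈ core B := by
  rw [mem_core_iff] at h ⊢
  rw [← map_star, ← map_plus, h.1, h.2, map_bot, map_top]
  exact ⟨rfl, rfl⟩

theorem fin_mem_core {x : Fin (n + 2)} (h₀ : x ≠ ⊥) (h₁ : x ≠ ⊤) : x ∈ core (Fin (n + 2)) := by
  rw [mem_core_iff, fin_star, fin_plus, if_neg h₀, if_neg h₁]
  exact ⟨rfl, rfl⟩

/-- The homomorphism from the two-element algebra to any other one. -/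
noncomputable def twoHom (A : Type u) [DoubleStoneAlgebra A] : DSHom (Fin 2) A :=
  chainHom (n := 0) (fun s => if s = ⊥ then ⊥ else ⊤)
    (fun s r h => by
      dsimp only
      split_ifs with h₁ h₂
      exacts [le_rfl, bot_le, absurd (le_bot_iff.1 (‹r = ⊥› ▸ h)) h₁, le_rfl])
    (if_pos rfl) (if_neg fin_bot_ne_top.symm)
    (fun s h₀ h₁ => by fin_cases s; exacts [absurd rfl h₀, absurd rfl h₁])

end Chain

/-! ### Clopen predicates represented by lattice elements -/

/-- Let a lattice `A` be represented by open-closed subsets `{y | σ a y}` of a compact space `Y`,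
with meets, joins and bounds represented as such. An open-closed set that is closed upwards for the
quasi-order induced by `A` is of the form `{y | σ a y}`. -/
theorem exists_forall_iff_of_clopen {A : Type u} [Lattice A] [BoundedOrder A] {Y : Type v}
    [TopologicalSpace Y] [CompactSpace Y] (σ : A → Y → Prop) (τ : Y → Prop)
    (hσ : ∀ a, IsClopen {y | σ a y}) (hτ : IsClopen {y | τ y})
    (h_top : ∀ y, σ ⊤ y) (h_bot : ∀ y, ¬ σ ⊥ y)
    (h_inf : ∀ a b y, σ (a ⊓ b) y ↔ σ a y ∧ σ b y)
    (h_sup : ∀ a b y, σ (a ⊔ b) y ↔ σ a y ∨ σ b y)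
    (h_up : ∀ y z, (∀ a, σ a y → σ a z) → τ y → τ z) : ∃ a, ∀ y, σ a y ↔ τ y := by
  -- for fixed `y`, finitely many elements that hold at `y` have a meet below `τ`
  have h₁ : ∀ y, τ y → ∃ a, σ a y ∧ ∀ z, σ a z → τ z := by
    intro y hy
    have : Nonempty {a // σ a y} := ⟨⟨⊤, h_top y⟩⟩
    obtain ⟨a, ha⟩ := isCompact_univ.elim_directed_cover
      (fun a : {a // σ a y} => {z | σ a z}ᶜ ∪ {z | τ z})
      (fun a => (hσ a).compl.isOpen.union hτ.isOpen)
      (fun z _ => by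
        by_contra hz
        simp only [Set.mem_iUnion, Set.mem_union, Set.mem_compl_iff, Set.mem_ofPred_eq, not_exists,
          not_or, not_not] at hz
        exact (hz ⟨⊤, h_top y⟩).2 (h_up y z (fun a ha => (hz ⟨a, ha⟩).1) hy))
      (fun a b => ⟨⟨a.1 ⊓ b.1, (h_inf _ _ _).2 ⟨a.2, b.2⟩⟩,
        Set.union_subset_union_left _ fun z hz h => hz ((h_inf _ _ _).1 h).1,
        Set.union_subset_union_left _ fun z hz h => hz ((h_inf _ _ _).1 h).2⟩)
    refine ⟨a.1, a.2, fun z hz => ?_⟩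
    exact (ha (Set.mem_univ z)).resolve_left fun h => h hz
  have : Nonempty {a // ∀ z, σ a z → τ z} := ⟨⟨⊥, fun z hz => absurd hz (h_bot z)⟩⟩
  obtain ⟨a, ha⟩ := hτ.isClosed.isCompact.elim_directed_cover
    (fun a : {a // ∀ z, σ a z → τ z} => {z | σ a z}) (fun a => (hσ a).isOpen)
    (fun y hy => by
      obtain ⟨a, ha, ha'⟩ := h₁ y hy
      exact Set.mem_iUnion.2 ⟨⟨a, ha'⟩, ha⟩)
    (fun a b => ⟨⟨a.1 ⊔ b.1, fun z hz => ((h_sup _ _ _).1 hz).elim (a.2 z) (b.2 z)⟩,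
      fun z hz => (h_sup _ _ _).2 (Or.inl hz), fun z hz => (h_sup _ _ _).2 (Or.inr hz)⟩)
  exact ⟨a.1, fun y => ⟨a.2 y, fun hy => ha hy⟩⟩

section Dual

variable {A : Type v} {L : Type u} [DoubleStoneAlgebra A] [DoubleStoneAlgebra L]

theorem isCompact_dual [Finite L] : @CompactSpace (DSHom A L) (dualTopology A L) := by
  let : TopologicalSpace L := ⊥
  have : DiscreteTopology L := ⟨rfl⟩
  let := dualTopology A L
  have h_emb : Topology.IsInducing (fun h : DSHom A L => (h : A → L)) := ⟨rfl⟩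
  have h_ev : ∀ a : A, Continuous fun f : A → L => f a := fun a => continuous_apply a
  refine (Topology.IsClosedEmbedding.mk ⟨h_emb, DFunLike.coe_injective⟩ ?_).compactSpace
  have h_range : Set.range (fun h : DSHom A L => (h : A → L)) =
      {f : A → L | ∀ x y, f (x ⊔ y) = f x ⊔ f y} ∩ {f : A → L | ∀ x y, f (x ⊓ y) = f x ⊓ f y} ∩
      {f : A → L | ∀ x, f (star x) = DoubleStoneAlgebra.star (f x)} ∩
      {f : A → L | ∀ x, f (plus x) = plus (f x)} ∩
      {f : A → L | f ⊥ = ⊥} ∩ {f : A → L | f ⊤ = ⊤} := by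
    ext f
    constructor
    · rintro ⟨h, rfl⟩
      exact ⟨⟨⟨⟨⟨map_sup h, map_inf h⟩, map_star h⟩, map_plus h⟩, map_bot h⟩, map_top h⟩
    · rintro ⟨⟨⟨⟨⟨h₁, h₂⟩, h₃⟩, h₄⟩, h₅⟩, h₆⟩
      exact ⟨⟨f, h₁, h₂, h₃, h₄, h₅, h₆⟩, rfl⟩
  have h₂ : ∀ (op : L → L → L) (x y : A),
      Continuous fun f : A → L => op (f x) (f y) := fun op x y =>
    (continuous_of_discreteTopology (f := fun p : L × L => op p.1 p.2)).comp
      ((h_ev x).prodMk (h_ev y))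
  have h₁ : ∀ (op : L → L) (x : A), Continuous fun f : A → L => op (f x) := fun op x =>
    continuous_of_discreteTopology.comp (h_ev x)
  rw [h_range]
  simp only [Set.ofPred_forall]
  refine ((((IsClosed.inter ?_ ?_).inter ?_).inter ?_).inter ?_).inter ?_
  · exact isClosed_iInter fun x => isClosed_iInter fun y => isClosed_eq (h_ev _) (h₂ _ x y)
  · exact isClosed_iInter fun x => isClosed_iInter fun y => isClosed_eq (h_ev _) (h₂ _ x y)
  · exact isClosed_iInter fun x => isClosed_eq (h_ev _) (h₁ _ x)
  · exact isClosed_iInter fun x => isClosed_eq (h_ev _) (h₁ _ x)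
  · exact isClosed_eq (h_ev _) continuous_const
  · exact isClosed_eq (h_ev _) continuous_const

/-- A continuous map `φ` from the dual of `A` to `L` is evaluation at an element of `A` if, for all
prime filters `F` and `G` of `L` that come from homomorphisms to a chain `R` separating the elements
of `L`, an inclusion between the prime filters `h⁻¹ F` and `k⁻¹ G` of `A` is respected by `φ`. -/
theorem exists_forall_eq_eval [Finite L] {n : ℕ}
    (h_sep : ∀ x y : L, (∀ q : DSHom L (Fin (n + 2)), q x = q y) → x = y) (φ : DSHom A L → L)
    (hφ : @Continuous _ _ (dualTopology A L) ⊥ φ)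
    (h_up : ∀ (h k : DSHom A L) (q r : DSHom L (Fin (n + 2))) (s t : Fin (n + 2)), s ≠ ⊥ → t ≠ ⊥ →
      (∀ a, s ≤ q (h a) → t ≤ r (k a)) → s ≤ q (φ h) → t ≤ r (φ k)) :
    ∃ a : A, ∀ h : DSHom A L, φ h = h a := by
  let : TopologicalSpace L := ⊥
  have : DiscreteTopology L := ⟨rfl⟩
  let := dualTopology A L
  have : CompactSpace (DSHom A L) := isCompact_dual
  let I := DSHom L (Fin (n + 2)) × {s : Fin (n + 2) // s ≠ ⊥}
  let : TopologicalSpace I := ⊥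
  have : DiscreteTopology I := ⟨rfl⟩
  have h_clopen : ∀ f : DSHom A L → L, Continuous f →
      IsClopen {y : DSHom A L × I | (y.2.2 : Fin (n + 2)) ≤ y.2.1 (f y.1)} := fun f hf =>
    (isClopen_discrete {z : L × I | (z.2.2 : Fin (n + 2)) ≤ z.2.1 z.1}).preimage
      ((hf.comp continuous_fst).prodMk continuous_snd)
  obtain ⟨a, ha⟩ := exists_forall_iff_of_clopen
    (fun (a : A) (y : DSHom A L × I) => (y.2.2 : Fin (n + 2)) ≤ y.2.1 (y.1 a))
    (fun y => (y.2.2 : Fin (n + 2)) ≤ y.2.1 (φ y.1))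
    (fun a => h_clopen (fun h => h a)
      ((continuous_apply a).comp (continuous_induced_dom (f := fun h : DSHom A L => (h : A → L)))))
    (h_clopen φ hφ)
    (fun y => by rw [map_top, map_top]; exact le_top)
    (fun y hy => by rw [map_bot, map_bot, le_bot_iff] at hy; exact y.2.2.2 hy)
    (fun a b y => by rw [map_inf, map_inf, le_inf_iff])
    (fun a b y => by rw [map_sup, map_sup, fin_le_sup])
    (fun y z hyz => h_up y.1 z.1 y.2.1 z.2.1 _ _ y.2.2.2 z.2.2.2 hyz)
  exact ⟨a, fun h => h_sep _ _ fun q => fin_eq_of_forall_le_iff fun s hs =>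
    (ha (h, q, ⟨s, hs⟩)).symm⟩

end Dual

/-! ### Endodualisability from retracts -/

section Compatible

variable {A : Type v} [DoubleStoneAlgebra A] {n m : ℕ}

/-- `ψ` respects the inclusions between the prime filters of `A` that come from homomorphisms to the
chain. -/
def Compatible (ψ : DSHom A (Fin (n + 2)) → Fin (n + 2)) : Prop :=
  ∀ (h k : DSHom A (Fin (n + 2))) (s t : Fin (n + 2)), s ≠ ⊥ → t ≠ ⊥ →
    (∀ a, s ≤ h a → t ≤ k a) → s ≤ ψ h → t ≤ ψ k

/-- `ψ` commutes with the action of the endomorphisms of the chain. -/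
def Equivariant (ψ : DSHom A (Fin (n + 2)) → Fin (n + 2)) : Prop :=
  ∀ (e : DSHom (Fin (n + 2)) (Fin (n + 2))) (h : DSHom A (Fin (n + 2))), ψ (e.comp h) = e (ψ h)

/-- Comparable prime filters contain the same complemented elements, so homomorphisms they come from
agree on what is sent to a bound. -/
theorem eq_bot_iff_and_eq_top_iff {h : DSHom A (Fin (n + 2))} {k : DSHom A (Fin (m + 2))}
    {s : Fin (n + 2)} {t : Fin (m + 2)} (hs : s ≠ ⊥) (ht : t ≠ ⊥) (hhk : ∀ a, s ≤ h a → t ≤ k a)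
    (x : A) : (h x = ⊥ ↔ k x = ⊥) ∧ (h x = ⊤ ↔ k x = ⊤) := by
  have h_star : ∀ {l : ℕ} (r : Fin (l + 2)), r ≠ ⊥ → ∀ y : Fin (l + 2),
      (r ≤ star y ↔ y = ⊥) ∧ (r ≤ star (star y) ↔ y ≠ ⊥) ∧
      (r ≤ plus y ↔ y ≠ ⊤) ∧ (r ≤ plus (plus y) ↔ y = ⊤) := by
    intro l r hr y
    have h₁ : ¬ r ≤ ⊥ := fun h => hr (le_bot_iff.1 h)
    have h₂ : r ≤ ⊤ := le_top
    have h₃ : (⊥ : Fin (l + 2)) ≠ ⊤ := fin_bot_ne_top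
    simp only [fin_star, fin_plus]
    by_cases hy : y = ⊥ <;> by_cases hy' : y = ⊤ <;> simp_all
  have h₁ := hhk (star x)
  have h₂ := hhk (star (star x))
  have h₃ := hhk (plus x)
  have h₄ := hhk (plus (plus x))
  have hh := h_star s hs (h x)
  have hk := h_star t ht (k x)
  simp only [map_star, map_plus] at h₁ h₂ h₃ h₄
  rw [hh.1, hk.1] at h₁
  rw [hh.2.1, hk.2.1] at h₂
  rw [hh.2.2.1, hk.2.2.1] at h₃
  rw [hh.2.2.2, hk.2.2.2] at h₄
  exact ⟨⟨h₁, not_imp_not.1 h₂⟩, h₄, not_imp_not.1 h₃⟩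

/-- The endomorphism of the five-element chain that sends the core elements from `s` on to `3` and
the other ones to `1`. -/
def thresholdHom (s : Fin 5) : DSHom (Fin 5) (Fin 5) :=
  chainHom (n := 3) (fun y => if y = 0 then 0 else if y = 4 then 4 else if s ≤ y then 3 else 1)
    (by intro x y; revert s x y; decide) (by simp [fin_bot]) rfl
    (fun y h₀ h₁ => fin_mem_core (by revert s y; decide) (by revert s y; decide))

theorem thresholdHom_apply (s y : Fin 5) : thresholdHom s y =
    if y = 0 then 0 else if y = 4 then 4 else if s ≤ y then 3 else 1 := rfl

/-- Comparable prime filters are the inverse images of `{3, 4}` and `{2, 3, 4}` under one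
homomorphism to the five-element chain, and the endomorphisms of this chain reduce every other
inverse image to these two. -/
theorem compatible_five (ψ : DSHom A (Fin 5) → Fin 5) (hψ : Equivariant (n := 3) ψ) :
    Compatible (n := 3) ψ := by
  intro h k s t hs ht hhk hsψ
  obtain ⟨g, hg⟩ := exists_hom_five ((isPrimePred_le hs).comp h) ((isPrimePred_le ht).comp k) hhk
  have h_eq : ∀ (f : DSHom A (Fin 5)) (r r' : Fin 5), r ≠ ⊥ → r' ≠ ⊥ →
      (∀ a, r' ≤ g a ↔ r ≤ f a) → (thresholdHom r').comp g = (thresholdHom r).comp f := by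
    intro f r r' hr hr' hfg
    refine hom_ext fun a => ?_
    obtain ⟨h₁, h₂⟩ := eq_bot_iff_and_eq_top_iff hr' hr (fun a => (hfg a).1) a
    have h₁' : g a = 0 ↔ f a = 0 := h₁
    have h₂' : g a = 4 ↔ f a = 4 := h₂
    simp only [comp_apply, thresholdHom_apply, hfg, h₁', h₂']
  have h₁ : ∀ r y : Fin 5, r ≠ ⊥ → (3 ≤ thresholdHom r y ↔ r ≤ y) := by decide
  have h₂ : ∀ y : Fin 5, 3 ≤ y → 2 ≤ y := by decide
  rw [← h₁ s _ hs, ← hψ, ← h_eq h s 3 hs (by decide) fun a => (hg a).2, hψ,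
    h₁ 3 _ (by decide)] at hsψ
  rw [← h₁ t _ ht, ← hψ, ← h_eq k t 2 ht (by decide) fun a => (hg a).1, hψ, h₁ 2 _ (by decide)]
  exact h₂ _ hsψ

theorem exists_twoHom_comp_eq (h : DSHom A (Fin (n + 2))) (hh : ∀ a, h a = ⊥ ∨ h a = ⊤) :
    ∃ w : DSHom A (Fin 2), (twoHom (Fin (n + 2))).comp w = h := by
  have h_ne : (⊥ : Fin (n + 2)) ≠ ⊤ := fin_bot_ne_top
  have hP := (isPrimePred_le (n := n) h_ne.symm).comp h
  simp only [top_le_iff] at hP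
  obtain ⟨w, hw⟩ := exists_hom_of_isPrimePred (n := 0) (fun _ x => h x = ⊤) (fun _ _ => hP)
    (fun _ _ _ _ _ => id)
    (fun s x hs => by
      rw [map_star, fin_star]
      have := hh x
      constructor
      · intro h₁ r _ h₂
        rw [h₂, if_neg h_ne.symm] at h₁
        exact h_ne h₁
      · intro h₁
        rw [if_pos (this.resolve_right (h₁ s hs))])
    (fun s x hs => by
      rw [map_plus, fin_plus]
      split_ifs with h₁
      · exact iff_of_false h_ne fun h₂ => h₂ h₁
      · exact iff_of_true rfl h₁)
  refine ⟨w, hom_ext fun a => ?_⟩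
  have hwa := hw 1 a (by decide)
  change (if w a = ⊥ then ⊥ else ⊤) = h a
  rcases hh a with h₁ | h₁
  · rw [h₁, if_pos]
    have : ¬ 1 ≤ w a := fun h₂ => h_ne (h₁.symm.trans (hwa.1 h₂))
    generalize w a = y at this
    revert this; revert y; decide
  · rw [h₁, if_neg]
    have : 1 ≤ w a := hwa.2 h₁
    generalize w a = y at this
    revert this; revert y; decide

/-- Two comparable prime filters come from the same homomorphism to the three-element chain; if they
are equal but come from different elements of the chain, this homomorphism is two-valued. -/
theorem compatible_three (ψ : DSHom A (Fin 3) → Fin 3)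
    (hψ : ∀ w : DSHom A (Fin 2),
      ψ ((twoHom (Fin 3)).comp w) = ⊥ ∨ ψ ((twoHom (Fin 3)).comp w) = ⊤) :
    Compatible (n := 1) ψ := by
  intro h k s t hs ht hhk
  have key : ∀ x y : Fin 3, (x = ⊥ ↔ y = ⊥) → (x = ⊤ ↔ y = ⊤) → x = y := by decide
  obtain rfl : h = k := hom_ext fun a =>
    key _ _ (eq_bot_iff_and_eq_top_iff hs ht hhk a).1 (eq_bot_iff_and_eq_top_iff hs ht hhk a).2
  rcases le_or_gt t s with hts | hst
  · exact hts.trans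
  · have h₁ : ∀ s t : Fin 3, s ≠ ⊥ → s < t → ∀ y, (s ≤ y → t ≤ y) → y = ⊥ ∨ y = ⊤ := by decide
    have h₂ : ∀ s t : Fin 3, s ≠ ⊥ → ∀ y, y = ⊥ ∨ y = ⊤ → s ≤ y → t ≤ y := by decide
    obtain ⟨w, rfl⟩ := exists_twoHom_comp_eq (n := 1) h fun a => h₁ s t hs hst _ (hhk a)
    exact h₂ s t hs _ (hψ w)

theorem compatible_two (ψ : DSHom A (Fin 2) → Fin 2) : Compatible (n := 0) ψ := by
  intro h k s t hs ht hhk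
  have h₁ : ∀ s : Fin 2, s ≠ ⊥ → s = ⊤ := by decide
  have h₂ : ∀ x y : Fin 2, (x = ⊤ ↔ y = ⊤) → x = y := by decide
  obtain rfl : h = k := hom_ext fun a => h₂ _ _ (eq_bot_iff_and_eq_top_iff hs ht hhk a).2
  rw [h₁ s hs, h₁ t ht]
  exact id

end Compatible

section Retract

variable {L : Type u} [DoubleStoneAlgebra L] [Finite L] {n : ℕ}

/-- Duality for `ISP(L)` follows from the analogous statement about a retract `R` of `L` that is a
chain and generates `ISP(L)`. -/
theorem endodualisable_of_isRetractOf
    (h_comp : ∀ (A : Type v) [DoubleStoneAlgebra A] (ψ : DSHom A (Fin (n + 2)) → Fin (n + 2)),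
      Equivariant ψ → Compatible ψ)
    (h_sep : ∀ x y : L, (∀ q : DSHom L (Fin (n + 2)), q x = q y) → x = y)
    (h_ret : IsRetractOf (Fin (n + 2)) L) : Endodualisable.{u, v} L := by
  intro A _ hA φ ⟨hφ, hφ_end⟩
  obtain ⟨i, p, hpi⟩ := h_ret
  have h_eq : ∀ (q : DSHom L (Fin (n + 2))) (h : DSHom A L),
      q (φ h) = p (φ (i.comp (q.comp h))) := fun q h => by
    rw [← hpi (q (φ h))]
    exact congrArg p (hφ_end (i.comp q) h).symm
  have hψ : Compatible fun h : DSHom A (Fin (n + 2)) => p (φ (i.comp h)) := by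
    refine h_comp A _ fun e h => ?_
    have h₁ := h_eq (e.comp p) (i.comp h)
    rw [comp_apply] at h₁
    rw [h₁]
    congr 3
    exact hom_ext fun a => congrArg e (hpi (h a)).symm
  obtain ⟨a, ha⟩ := exists_forall_eq_eval h_sep φ hφ fun h k q r s t hs ht hhk hsq => by
    rw [h_eq] at hsq ⊢
    exact hψ (q.comp h) (r.comp k) s t hs ht hhk hsq
  exact ⟨a, ha, fun b hb => memISP_iff.1 hA b a fun h => (hb h).symm.trans (ha h)⟩

/-- If the retract is `R × 𝟐 × 𝟐`, the two additional factors make the first coordinate of `φ`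
independent of the last two, and provide that it is two-valued on two-valued homomorphisms. -/
theorem endodualisable_of_isRetractOf_prod
    (h_comp : ∀ (A : Type v) [DoubleStoneAlgebra A] (ψ : DSHom A (Fin (n + 2)) → Fin (n + 2)),
      Equivariant ψ → (∀ w : DSHom A (Fin 2), ψ ((twoHom (Fin (n + 2))).comp w) = ⊥ ∨
        ψ ((twoHom (Fin (n + 2))).comp w) = ⊤) → Compatible ψ)
    (h_sep : ∀ x y : L, (∀ q : DSHom L (Fin (n + 2)), q x = q y) → x = y)
    (h_ret : IsRetractOf (Fin (n + 2) × (Fin 2 × Fin 2)) L) : Endodualisable.{u, v} L := by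
  intro A _ hA φ ⟨hφ, hφ_end⟩
  obtain ⟨i, p, hpi⟩ := h_ret
  by_cases h_ne : Nonempty (DSHom A L)
  swap
  · exact ⟨⊥, fun h => absurd ⟨h⟩ h_ne, fun b _ => memISP_iff.1 hA b ⊥ fun h => absurd ⟨h⟩ h_ne⟩
  obtain ⟨h₀⟩ := h_ne
  let R := Fin (n + 2)
  let ι := twoHom (Fin (n + 2))
  let p₀ : DSHom L R := (fstHom R (Fin 2 × Fin 2)).comp p
  let p₁ : DSHom L (Fin 2) := ((fstHom _ _).comp (sndHom R (Fin 2 × Fin 2))).comp p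
  let p₂ : DSHom L (Fin 2) := ((sndHom _ _).comp (sndHom R (Fin 2 × Fin 2))).comp p
  -- all homomorphisms `A → L` that matter, and how endomorphisms of `L` act on them
  let J (h : DSHom A R) (v w : DSHom A (Fin 2)) : DSHom A L := i.comp (pairHom h (pairHom v w))
  let E (q : DSHom L R) (v w : DSHom L (Fin 2)) : DSHom L L := i.comp (pairHom q (pairHom v w))
  have hE : ∀ (q : DSHom L R) (v w : DSHom L (Fin 2)) (h : DSHom A L),
      p (φ (J (q.comp h) (v.comp h) (w.comp h))) = (q (φ h), v (φ h), w (φ h)) := fun q v w h => by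
    have h₁ := congrArg p (hφ_end (E q v w) h)
    have h₂ : p (E q v w (φ h)) = (q (φ h), v (φ h), w (φ h)) := hpi _
    rw [h₂] at h₁
    exact h₁
  have hp₀ : ∀ h v w, p₀.comp (J h v w) = h := fun h v w =>
    hom_ext fun a => congrArg Prod.fst (hpi (h a, v a, w a))
  have hp₁ : ∀ h v w, p₁.comp (J h v w) = v := fun h v w =>
    hom_ext fun a => congrArg (fun x => x.2.1) (hpi (h a, v a, w a))
  have hp₂ : ∀ h v w, p₂.comp (J h v w) = w := fun h v w =>
    hom_ext fun a => congrArg (fun x => x.2.2) (hpi (h a, v a, w a))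
  have hJ₁ : ∀ h v w, p₀ (φ (J h v v)) = p₀ (φ (J h v w)) := fun h v w => by
    have h₁ := congrArg Prod.fst (hE p₀ p₁ p₁ (J h v w))
    rwa [hp₀, hp₁] at h₁
  have hJ₂ : ∀ h v w, p₀ (φ (J h w w)) = p₀ (φ (J h v w)) := fun h v w => by
    have h₁ := congrArg Prod.fst (hE p₀ p₂ p₂ (J h v w))
    rwa [hp₀, hp₂] at h₁
  have hJ : ∀ h v w v' w', p₀ (φ (J h v w)) = p₀ (φ (J h v' w')) := fun h v w v' w' => by
    rw [← hJ₁, hJ₁ h v w', ← hJ₂, hJ₂]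
  let ψ (h : DSHom A R) : R := p₀ (φ (J h (p₁.comp h₀) (p₂.comp h₀)))
  have h_eq : ∀ (q : DSHom L R) (h : DSHom A L), q (φ h) = ψ (q.comp h) := fun q h => by
    have h₁ := congrArg Prod.fst (hE q p₁ p₂ h)
    exact h₁.symm.trans (hJ _ _ _ _ _)
  have hψ : Compatible ψ := by
    refine h_comp A ψ (fun e h => ?_) fun w => ?_
    · have h₁ := h_eq (e.comp p₀) (J h (p₁.comp h₀) (p₂.comp h₀))
      refine Eq.trans ?_ h₁.symm
      congr 1
      exact congrArg e.comp (hp₀ _ _ _).symm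
    · have h₁ := h_eq (ι.comp p₁) (J (ι.comp w) w w)
      have h₂ : (ι.comp p₁).comp (J (ι.comp w) w w) = ι.comp w := congrArg ι.comp (hp₁ _ _ _)
      rw [h₂] at h₁
      rw [← h₁]
      change (if _ then ⊥ else ⊤) = ⊥ ∨ (if _ then ⊥ else ⊤) = ⊤
      split_ifs
      exacts [Or.inl rfl, Or.inr rfl]
  obtain ⟨a, ha⟩ := exists_forall_eq_eval h_sep φ hφ fun h k q r s t hs ht hhk hsq => by
    rw [h_eq] at hsq ⊢
    exact hψ (q.comp h) (r.comp k) s t hs ht hhk hsq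
  exact ⟨a, ha, fun b hb => memISP_iff.1 hA b a fun h => (hb h).symm.trans (ha h)⟩

end Retract

/-! ### Endodualisable algebras are endoprimal -/

/-- A subset of a double Stone algebra that is closed under the operations, parametrised injectively
by a type, makes this type a double Stone algebra. -/
theorem exists_doubleStoneAlgebra_of_injective {A : Type v} {B : Type w} [DoubleStoneAlgebra B]
    (f : A → B) (hf : Function.Injective f)
    (h_sup : ∀ x y, ∃ z, f z = f x ⊔ f y) (h_inf : ∀ x y, ∃ z, f z = f x ⊓ f y)
    (h_star : ∀ x, ∃ z, f z = star (f x)) (h_plus : ∀ x, ∃ z, f z = plus (f x))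
    (h_bot : ∃ z, f z = ⊥) (h_top : ∃ z, f z = ⊤) :
    ∃ (_ : DoubleStoneAlgebra A) (g : DSHom A B), ∀ x, g x = f x := by
  choose sup hsup using h_sup
  choose inf hinf using h_inf
  choose st hst using h_star
  choose pl hpl using h_plus
  obtain ⟨b, hb⟩ := h_bot
  obtain ⟨t, ht⟩ := h_top
  let _ : Max A := ⟨sup⟩
  let _ : Min A := ⟨inf⟩
  let _ : LE A := ⟨fun x y => f x ≤ f y⟩
  let _ : LT A := ⟨fun x y => f x < f y⟩
  let lat : DistribLattice A := hf.distribLattice f Iff.rfl Iff.rfl hsup hinf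
  have h_le : ∀ {x y : A}, x ≤ y ↔ f x ≤ f y := Iff.rfl
  let bdd : BoundedOrder A :=
    { bot := b, top := t
      bot_le := fun x => by rw [h_le]; exact hb.le.trans bot_le
      le_top := fun x => by rw [h_le]; exact le_top.trans ht.ge }
  have hbot : f ⊥ = ⊥ := hb
  have htop : f ⊤ = ⊤ := ht
  have hsup' : ∀ x y, f (x ⊔ y) = f x ⊔ f y := hsup
  have hinf' : ∀ x y, f (x ⊓ y) = f x ⊓ f y := hinf
  let inst : DoubleStoneAlgebra A :=
    { lat, bdd with
      star := st
      plus := pl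
      le_star_iff := fun x y => by
        rw [h_le, hst, le_star_iff, ← hf.eq_iff, hinf', hbot]
      star_sup_star_star := fun x => by
        rw [← hf.eq_iff, hsup', htop, hst, hst, hst, star_sup_star_star]
      plus_le_iff := fun x y => by
        rw [h_le, hpl, plus_le_iff, ← hf.eq_iff, hsup', htop]
      plus_inf_plus_plus := fun x => by
        rw [← hf.eq_iff, hinf', hbot, hpl, hpl, hpl, plus_inf_plus_plus] }
  exact ⟨inst, ⟨f, hsup, hinf, hst, hpl, hb, ht⟩, fun _ => rfl⟩

theorem map_eval {A : Type u} {B : Type v} [DoubleStoneAlgebra A] [DoubleStoneAlgebra B]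
    (f : DSHom A B) {k : ℕ} (x : Fin k → A) (t : DSTerm k) :
    f (t.eval x) = t.eval fun i => f (x i) := by
  induction t with
  | var i => rfl
  | bot => exact map_bot f
  | top => exact map_top f
  | sup s t hs ht => simp only [DSTerm.eval, map_sup, hs, ht]
  | inf s t hs ht => simp only [DSTerm.eval, map_inf, hs, ht]
  | star t ht => simp only [DSTerm.eval, map_star, ht]
  | plus t ht => simp only [DSTerm.eval, map_plus, ht]

/-- An operation commuting with the endomorphisms of `L` is a morphism on the dual of the algebra of
`k`-ary term functions, because the homomorphisms from that algebra to `L` are determined by `k`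
elements. The algebra is finite, hence has a copy in every universe. -/
theorem Endodualisable.kEndoprimal {L : Type u} [DoubleStoneAlgebra L] [Finite L]
    (hL : Endodualisable.{u, v} L) (k : ℕ) : KEndoprimal k L := by
  intro F hF
  let T : Set ((Fin k → L) → L) := Set.range fun (t : DSTerm k) x => t.eval x
  obtain ⟨n, ⟨e⟩⟩ := Finite.exists_equiv_fin T
  let f : ULift.{v} (Fin n) → (Fin k → L) → L := fun i => (e.symm i.down).1
  have hf : Function.Injective f :=
    Subtype.val_injective.comp (e.symm.injective.comp ULift.down_injective)
  have h_ex : ∀ t : DSTerm k, ∃ i, f i = fun x => t.eval x := fun t =>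
    ⟨⟨e ⟨_, t, rfl⟩⟩, by simp [f]⟩
  have h_mem : ∀ i, ∃ t : DSTerm k, (fun x => t.eval x) = f i := fun i => (e.symm i.down).2
  choose tm htm using h_mem
  obtain ⟨_, g, hg⟩ := exists_doubleStoneAlgebra_of_injective f hf
    (fun i j => by rw [← htm i, ← htm j]; exact h_ex (.sup (tm i) (tm j)))
    (fun i j => by rw [← htm i, ← htm j]; exact h_ex (.inf (tm i) (tm j)))
    (fun i => by rw [← htm i]; exact h_ex (.star (tm i)))
    (fun i => by rw [← htm i]; exact h_ex (.plus (tm i)))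
    (h_ex .bot) (h_ex .top)
  choose π hπ using fun i : Fin k => h_ex (.var i)
  let ev (x : Fin k → L) : DSHom (ULift.{v} (Fin n)) L :=
    ⟨fun i => g i x, fun i j => congrFun (map_sup g i j) x, fun i j => congrFun (map_inf g i j) x,
      fun i => congrFun (map_star g i) x, fun i => congrFun (map_plus g i) x,
      congrFun (map_bot g) x, congrFun (map_top g) x⟩
  have h_ev : ∀ x i, ev x i = f i x := fun x i => congrFun (hg i) x
  have h_isp : MemISP L (ULift.{v} (Fin n)) := memISP_iff.2 fun i j hij =>
    hf (funext fun x => by rw [← h_ev, ← h_ev, hij])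
  obtain ⟨a, ha, -⟩ := hL _ h_isp (fun h => F fun i => h (π i)) ⟨by
    let _ : TopologicalSpace L := ⊥
    have : DiscreteTopology L := ⟨rfl⟩
    let _ := dualTopology (ULift.{v} (Fin n)) L
    have h₁ : Continuous fun h : DSHom (ULift.{v} (Fin n)) L => fun i : Fin k => h (π i) :=
      continuous_pi fun i => (continuous_apply (π i)).comp
        (continuous_induced_dom (f := fun h : DSHom (ULift.{v} (Fin n)) L => (h : _ → L)))
    exact continuous_of_discreteTopology.comp h₁, fun e h => hF e fun i => h (π i)⟩
  refine ⟨tm a, fun x => ?_⟩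
  have h₁ := ha (ev x)
  rw [h_ev, ← htm a] at h₁
  refine Eq.trans (congrArg F (funext fun i => ?_)) h₁
  rw [h_ev, hπ]
  rfl

/-! ### The support of the core -/

section Support

variable {L : Type u} [DoubleStoneAlgebra L]

/-- The complemented element of `L` that marks the factors of `L` in which the component of `x` is
different from both bounds, that is, belongs to the core of the factor. -/
def support (x : L) : L := star (star x) ⊓ plus x

theorem map_support {M : Type v} [DoubleStoneAlgebra M] (f : DSHom L M) (x : L) :
    f (support x) = support (f x) := by
  simp only [support, map_inf, map_star, map_plus]

theorem fin_support {n : ℕ} (x : Fin (n + 2)) :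
    (support x = ⊤ ∧ x ≠ ⊥ ∧ x ≠ ⊤) ∨ (support x = ⊥ ∧ (x = ⊥ ∨ x = ⊤)) := by
  have h_ne : (⊥ : Fin (n + 2)) ≠ ⊤ := fin_bot_ne_top
  rw [support, fin_star, fin_star, fin_plus]
  by_cases h₀ : x = ⊥ <;> by_cases h₁ : x = ⊤ <;> simp_all [h_ne.symm]

theorem support_eq_top_iff {x : L} : support x = ⊤ ↔ x ∈ core L := by
  rw [support, inf_eq_top_iff, mem_core_iff]
  refine and_congr_left fun _ => ⟨fun h => ?_, fun h => by rw [h, star_bot]⟩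
  rw [← star_star_star, h, star_top]

theorem isCompl_support (x : L) : IsCompl (support x) (star (support x)) := by
  have h : ∀ y : Fin 5, support y ⊓ star (support y) = ⊥ ∧ support y ⊔ star (support y) = ⊤ := by
    decide
  refine IsCompl.of_eq (inf_star_self _) (eq_of_forall_hom_eq fun q => ?_)
  rw [map_sup, map_star, map_support, (h _).2, map_top]

/-- Gluing `c` and `x` along the support of `c` unites the supports. -/
theorem exists_support_le (L : Type u) [DoubleStoneAlgebra L] [Finite L] :
    ∃ c : L, ∀ x, support x ≤ support c := by
  obtain ⟨c, -, hc⟩ := (Set.finite_univ (α := L)).exists_maximalFor support Set.univ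
    ⟨⊥, Set.mem_univ _⟩
  refine ⟨c, fun x => ?_⟩
  have h : ∀ c x : Fin 5, support ((support c ⊓ c) ⊔ (star (support c) ⊓ x)) =
      support c ⊔ support x := by decide
  have h' : support ((support c ⊓ c) ⊔ (star (support c) ⊓ x)) = support c ⊔ support x :=
    eq_of_forall_hom_eq fun q => by
      simp only [map_support, map_sup, map_inf, map_star, h]
  have h₁ := hc (Set.mem_univ ((support c ⊓ c) ⊔ (star (support c) ⊓ x)))
  rw [h'] at h₁
  exact le_sup_right.trans (h₁ le_sup_left)

/-- If no element has support, then `L` is Boolean. -/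
theorem isBooleanLattice_of_support_eq_bot (h : ∀ x : L, support x = ⊥) : IsBooleanLattice L := by
  refine ⟨⊥, ⊤, isBot_bot, isTop_top, fun x => ⟨star x, inf_star_self x, ?_⟩⟩
  have h₁ : ∀ y : Fin 5, support y = ⊥ → y ⊔ star y = ⊤ := by decide
  refine eq_of_forall_hom_eq fun q => ?_
  rw [map_sup, map_star, map_top, h₁]
  rw [← map_support, h, map_bot]

/-- Prime filters that contain the complement of the largest support are filters of homomorphisms to
the two-element algebra. -/
theorem exists_hom_two {c : L} (hc : ∀ x, support x ≤ support c) {P : L → Prop}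
    (hP : IsPrimePred P) (hPc : P (star (support c))) :
    ∃ f : DSHom L (Fin 2), ∀ x, f x = ⊤ ↔ P x := by
  have h₁ : ∀ x y : Fin 5, support x ≤ support y →
      star (support y) ≤ x ⊔ star x ∧ star (support y) ⊓ (x ⊓ plus x) = ⊥ := by decide
  have hx : ∀ x, support x ≤ support c := hc
  have h_star : ∀ x, P x ∨ P (star x) := fun x => by
    rw [← hP.sup]
    refine hP.mono (le_of_forall_hom_le fun q => ?_) hPc
    have := map_mono q (hc x)
    rw [map_support, map_support] at this
    simpa only [map_sup, map_star, map_support] using (h₁ _ _ this).1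
  have h_plus : ∀ x, ¬ (P x ∧ P (plus x)) := fun x => by
    rw [← hP.inf]
    intro h
    refine hP.bot ?_
    have h₂ : star (support c) ⊓ (x ⊓ plus x) = ⊥ := eq_of_forall_hom_eq fun q => by
      have := map_mono q (hc x)
      rw [map_support, map_support] at this
      simpa only [map_inf, map_star, map_plus, map_support, map_bot] using (h₁ _ _ this).2
    rw [← h₂, hP.inf]
    exact ⟨hPc, h⟩
  have h_star' : ∀ x, ¬ (P x ∧ P (star x)) := fun x => by
    rw [← hP.inf, inf_star_self]
    exact hP.bot
  have h_plus' : ∀ x, P x ∨ P (plus x) := fun x => by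
    rw [← hP.sup, sup_plus_self]
    exact hP.top
  obtain ⟨f, hf⟩ := exists_hom_of_isPrimePred (n := 0) (fun _ x => P x) (fun _ _ => hP)
    (fun _ _ _ _ _ => id)
    (fun s x hs => ⟨fun h _ _ hx => h_star' x ⟨hx, h⟩, fun h => (h_star x).resolve_left (h s hs)⟩)
    (fun s x hs => ⟨fun h hx => h_plus x ⟨hx, h⟩, fun h => (h_plus' x).resolve_left h⟩)
  exact ⟨f, fun x => by rw [← hf ⊤ x fin_bot_ne_top.symm, top_le_iff]⟩

/-- The elements below `e` with support `e`: if `e` is the largest support, this is the core of the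
factor `[⊥, e]` of `L`. -/
def coreBelow (e : L) : Set L := {x | x ≤ e ∧ support x = e}

theorem mem_coreBelow_iff {e x : L} : x ∈ coreBelow e ↔ ∀ q : DSHom L (Fin 5),
    (q e = ⊤ ∧ q x ≠ ⊥ ∧ q x ≠ ⊤) ∨ (q e = ⊥ ∧ q x = ⊥) := by
  constructor
  · rintro ⟨h₁, h₂⟩ q
    have h₃ := map_mono q h₁
    rw [← h₂, map_support] at h₃ ⊢
    rcases fin_support (n := 3) (q x) with h | h
    · exact Or.inl h
    · rw [h.1, le_bot_iff] at h₃
      exact Or.inr ⟨h.1, h₃⟩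
  · intro h
    have h₁ : support (⊥ : Fin 5) = ⊥ := by decide
    refine ⟨le_of_forall_hom_le fun q => ?_, eq_of_forall_hom_eq fun q => ?_⟩
    · rcases h q with h | h
      · rw [h.1]; exact le_top
      · rw [h.2]; exact bot_le
    · rw [map_support]
      rcases h q with h | h
      · rw [h.1]
        rcases fin_support (n := 3) (q x) with h' | h'
        · exact h'.1
        · exact absurd h'.2 (not_or.2 h.2)
      · rw [h.1, h.2, h₁]

theorem mem_coreBelow_top_iff {x : L} : x ∈ coreBelow (⊤ : L) ↔ x ∈ core L := by
  rw [coreBelow, Set.mem_ofPred_eq, support_eq_top_iff]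
  exact and_iff_right le_top

theorem inf_mem_coreBelow (c : L) : support c ⊓ c ∈ coreBelow (support c) := by
  rw [mem_coreBelow_iff]
  intro q
  have : ∀ y : Fin 5, (support y = ⊤ ∧ support y ⊓ y ≠ ⊥ ∧ support y ⊓ y ≠ ⊤) ∨
      (support y = ⊥ ∧ support y ⊓ y = ⊥) := by decide
  simpa only [map_inf, map_support] using this (q c)

theorem coreBelow_sup {e x y : L} (hx : x ∈ coreBelow e) (hy : y ∈ coreBelow e) :
    x ⊔ y ∈ coreBelow e := by
  rw [mem_coreBelow_iff] at *
  intro q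
  have : ∀ e x y : Fin 5, (e = ⊤ ∧ x ≠ ⊥ ∧ x ≠ ⊤) ∨ (e = ⊥ ∧ x = ⊥) →
      (e = ⊤ ∧ y ≠ ⊥ ∧ y ≠ ⊤) ∨ (e = ⊥ ∧ y = ⊥) →
      (e = ⊤ ∧ x ⊔ y ≠ ⊥ ∧ x ⊔ y ≠ ⊤) ∨ (e = ⊥ ∧ x ⊔ y = ⊥) := by decide
  rw [map_sup]
  exact this _ _ _ (hx q) (hy q)

theorem coreBelow_inf {e x y : L} (hx : x ∈ coreBelow e) (hy : y ∈ coreBelow e) :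
    x ⊓ y ∈ coreBelow e := by
  rw [mem_coreBelow_iff] at *
  intro q
  have : ∀ e x y : Fin 5, (e = ⊤ ∧ x ≠ ⊥ ∧ x ≠ ⊤) ∨ (e = ⊥ ∧ x = ⊥) →
      (e = ⊤ ∧ y ≠ ⊥ ∧ y ≠ ⊤) ∨ (e = ⊥ ∧ y = ⊥) →
      (e = ⊤ ∧ x ⊓ y ≠ ⊥ ∧ x ⊓ y ≠ ⊤) ∨ (e = ⊥ ∧ x ⊓ y = ⊥) := by decide
  rw [map_inf]
  exact this _ _ _ (hx q) (hy q)

theorem coreBelow_of_le_of_le {e b x t : L} (hb : b ∈ coreBelow e) (ht : t ∈ coreBelow e)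
    (hbx : b ≤ x) (hxt : x ≤ t) : x ∈ coreBelow e := by
  rw [mem_coreBelow_iff] at *
  intro q
  have h₁ := map_mono q hbx
  have h₂ := map_mono q hxt
  rcases hb q with hb | hb <;> rcases ht q with ht | ht
  · refine Or.inl ⟨hb.1, fun h => ?_, fun h => ?_⟩
    · rw [h, le_bot_iff] at h₁
      exact hb.2.1 h₁
    · rw [h, top_le_iff] at h₂
      exact ht.2.2 h₂
  · exact absurd (ht.1.symm.trans hb.1) (by decide)
  · exact absurd (hb.1.symm.trans ht.1) (by decide)
  · rw [ht.2, le_bot_iff] at h₂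
    exact Or.inr ⟨hb.1, h₂⟩

/-- An element with support at least `v` can be cut to `v` and completed by an element with
support `e`. -/
theorem glue_mem_coreBelow {e v x b : L} (hb : b ∈ coreBelow e) (hv : IsCompl v (star v))
    (hve : v ≤ e) (hvx : v ≤ support x) : (v ⊓ x) ⊔ (star v ⊓ b) ∈ coreBelow e := by
  rw [mem_coreBelow_iff] at *
  intro q
  have h₁ : ∀ v : Fin 5, v ⊔ star v = ⊤ → v = ⊥ ∨ v = ⊤ := by decide
  have h₂ := congrArg q hv.sup_eq_top
  rw [map_sup, map_star, map_top] at h₂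
  have h₃ := map_mono q hve
  have h₄ := map_mono q hvx
  rw [map_support] at h₄
  rw [map_sup, map_inf, map_inf, map_star]
  rcases h₁ _ h₂ with h | h
  · rw [h, star_bot, bot_inf_eq, top_inf_eq, bot_sup_eq]
    exact hb q
  · rw [h, top_le_iff] at h₃ h₄
    rw [h, star_top, bot_inf_eq, top_inf_eq, sup_bot_eq]
    rcases fin_support (n := 3) (q x) with h' | h'
    · exact Or.inl ⟨h₃, h'.2⟩
    · exact absurd (h'.1.symm.trans h₄) (by decide)

theorem exists_least_of_inf_mem {α : Type u} [Lattice α] [Finite α] {S : Set α} (hS : S.Nonempty)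
    (h_inf : ∀ x ∈ S, ∀ y ∈ S, x ⊓ y ∈ S) : ∃ b ∈ S, ∀ x ∈ S, b ≤ x := by
  obtain ⟨b, hb⟩ := (Set.toFinite S).exists_minimal hS
  exact ⟨b, hb.1, fun x hx => (hb.2 (h_inf b hb.1 x hx) inf_le_left).trans inf_le_right⟩

theorem exists_greatest_of_sup_mem {α : Type u} [Lattice α] [Finite α] {S : Set α}
    (hS : S.Nonempty) (h_sup : ∀ x ∈ S, ∀ y ∈ S, x ⊔ y ∈ S) : ∃ t ∈ S, ∀ x ∈ S, x ≤ t := by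
  obtain ⟨t, ht⟩ := (Set.toFinite S).exists_maximal hS
  exact ⟨t, ht.1, fun x hx => le_sup_right.trans (ht.2 (h_sup t ht.1 x hx) le_sup_left)⟩

end Support

/-! ### Regular algebras -/

section Regular

variable {L : Type u} [DoubleStoneAlgebra L]

/-- The homomorphism between chains that identifies the elements of the core. -/
def collapseHom : DSHom (Fin 5) (Fin 3) :=
  chainHom (n := 3) (fun y => if y = 0 then 0 else if y = 4 then 2 else 1)
    (by intro x y; revert x y; decide) rfl rfl
    (fun y h₀ h₁ => fin_mem_core (n := 1) (by revert y; decide) (by revert y; decide))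

/-- Elements with the same images under homomorphisms to `𝟑` have the same support and agree outside
it; on the support they are equal if the core there is trivial. -/
theorem isRegular_of_coreBelow_subsingleton {c : L} (hc : ∀ x, support x ≤ support c)
    (h : (coreBelow (support c)).Subsingleton) : IsRegular L := by
  refine memISP_iff.2 fun x y hxy => ?_
  have h₁ : ∀ x y : Fin 5, collapseHom x = collapseHom y →
      support x = support y ∧ (support x = ⊤ ∨ x = y) := by decide
  have hq : ∀ q : DSHom L (Fin 5), support (q x) = support (q y) ∧
      (support (q x) = ⊤ ∨ q x = q y) := fun q => h₁ _ _ (hxy (collapseHom.comp q))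
  have h_supp : support x = support y := eq_of_forall_hom_eq fun q => by
    rw [map_support, map_support, (hq q).1]
  have h₂ := h (glue_mem_coreBelow (inf_mem_coreBelow c) (isCompl_support x) (hc x) le_rfl)
    (glue_mem_coreBelow (inf_mem_coreBelow c) (isCompl_support x) (hc x) h_supp.le)
  refine eq_of_forall_hom_eq fun q => (hq q).2.elim (fun h₃ => ?_) id
  have h₄ := congrArg q h₂
  simpa only [map_sup, map_inf, map_star, map_support q x, h₃, star_top, bot_inf_eq, top_inf_eq,
    sup_bot_eq] using h₄

theorem IsRegular.eq_of_mem_core (hL : IsRegular L) {x y : L} (hx : x ∈ core L) (hy : y ∈ core L) :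
    x = y := by
  have h : ∀ z : Fin 3, star z = ⊥ ∧ plus z = ⊤ → z = 1 := by decide
  refine memISP_iff.1 hL x y fun q => ?_
  rw [h _ (map_mem_core q hx), h _ (map_mem_core q hy)]

end Regular

/-! ### Operations that are not term functions -/

section Negative

variable {L : Type u} [DoubleStoneAlgebra L]

/-- On the core, term functions are monotone. -/
theorem eval_mono {k : ℕ} (t : DSTerm k) {x y : Fin k → Fin 5} (h : ∀ i, x i ≤ y i)
    (h_bot : ∀ i, x i = ⊥ ↔ y i = ⊥) (h_top : ∀ i, x i = ⊤ ↔ y i = ⊤) : t.eval x ≤ t.eval y := by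
  have h₂ : ∀ a b c d : Fin 5, (a ≤ b ∧ (a = ⊥ ↔ b = ⊥) ∧ (a = ⊤ ↔ b = ⊤)) →
      (c ≤ d ∧ (c = ⊥ ↔ d = ⊥) ∧ (c = ⊤ ↔ d = ⊤)) →
      (a ⊔ c ≤ b ⊔ d ∧ (a ⊔ c = ⊥ ↔ b ⊔ d = ⊥) ∧ (a ⊔ c = ⊤ ↔ b ⊔ d = ⊤)) ∧
      (a ⊓ c ≤ b ⊓ d ∧ (a ⊓ c = ⊥ ↔ b ⊓ d = ⊥) ∧ (a ⊓ c = ⊤ ↔ b ⊓ d = ⊤)) := by decide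
  have h₁ : ∀ a b : Fin 5, (a ≤ b ∧ (a = ⊥ ↔ b = ⊥) ∧ (a = ⊤ ↔ b = ⊤)) →
      (star a ≤ star b ∧ (star a = ⊥ ↔ star b = ⊥) ∧ (star a = ⊤ ↔ star b = ⊤)) ∧
      (plus a ≤ plus b ∧ (plus a = ⊥ ↔ plus b = ⊥) ∧ (plus a = ⊤ ↔ plus b = ⊤)) := by decide
  suffices H : t.eval x ≤ t.eval y ∧ (t.eval x = ⊥ ↔ t.eval y = ⊥) ∧
      (t.eval x = ⊤ ↔ t.eval y = ⊤) from H.1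
  induction t with
  | var i => exact ⟨h i, h_bot i, h_top i⟩
  | bot => exact ⟨le_rfl, Iff.rfl, Iff.rfl⟩
  | top => exact ⟨le_rfl, Iff.rfl, Iff.rfl⟩
  | sup s t hs ht => exact (h₂ _ _ _ _ hs ht).1
  | inf s t hs ht => exact (h₂ _ _ _ _ hs ht).2
  | star t ht => exact (h₁ _ _ ht).1
  | plus t ht => exact (h₁ _ _ ht).2

/-- An element `y` that is close enough to a complement of `m` can be corrected to a complement of
`m` in the interval `[lo, hi]`. -/
theorem relative_complement {α : Type u} [DistribLattice α] {lo m hi y : α} (h₁ : lo ≤ m)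
    (h₂ : m ≤ hi) (h₃ : m ⊓ y ≤ lo) (h₄ : hi ≤ m ⊔ y) :
    (lo ⊔ y ⊓ hi) ⊓ m = lo ∧ (lo ⊔ y ⊓ hi) ⊔ m = hi := by
  constructor
  · refine le_antisymm ?_ (le_inf le_sup_left h₁)
    rw [inf_sup_right]
    refine sup_le inf_le_left (le_trans ?_ h₃)
    exact le_inf inf_le_right (inf_le_left.trans inf_le_left)
  · refine le_antisymm (sup_le (sup_le (h₁.trans h₂) inf_le_right) h₂) ?_
    calc hi ≤ (m ⊔ y) ⊓ (m ⊔ hi) := le_inf h₄ le_sup_right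
      _ = m ⊔ y ⊓ hi := sup_inf_left _ _ _ |>.symm
      _ ≤ _ := sup_le le_sup_right (le_sup_right.trans le_sup_left)

/-- Let the core of the factor `[⊥, e]` be Boolean, where `e` is the largest support. For `x`, `y`,
`z` in the core, the complement of `x ⊓ z ⊔ y ⊓ (x ⊔ z)` in the interval `[x ⊓ z, x ⊔ z]` is
preserved by all homomorphisms, and for `x ≤ z` it is decreasing in `y ∈ [x, z]`, which a term
function cannot be. The operation is extended to all of `L` by cutting down to the part `s` of `L`
where all three arguments lie in the core. -/
theorem not_kEndoprimal_three {c b t : L} (hc : ∀ x, support x ≤ support c)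
    (hb : b ∈ coreBelow (support c)) (ht : t ∈ coreBelow (support c))
    (hb_le : ∀ x ∈ coreBelow (support c), b ≤ x) (ht_ge : ∀ x ∈ coreBelow (support c), x ≤ t)
    (h_compl : ∀ x ∈ coreBelow (support c), ∃ y ∈ coreBelow (support c), x ⊓ y = b ∧ x ⊔ y = t)
    (hbt : b ≠ t) : ¬ KEndoprimal 3 L := by
  let s (x : Fin 3 → L) : L := support (x 0) ⊓ support (x 1) ⊓ support (x 2)
  let lo (x : Fin 3 → L) : L := s x ⊓ (x 0 ⊓ x 2)
  let hi (x : Fin 3 → L) : L := s x ⊓ (x 0 ⊔ x 2)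
  let M (x : Fin 3 → L) : L := x 0 ⊓ x 2 ⊔ x 1 ⊓ (x 0 ⊔ x 2)
  have hs_compl : ∀ x, IsCompl (s x) (star (s x)) := fun x => by
    have h := (((isCompl_support (x 0)).inf_sup (isCompl_support (x 1))).inf_sup
      (isCompl_support (x 2)))
    rwa [← star_eq_of_isCompl h] at h
  have hs_le : ∀ x i, s x ≤ support (x i) := fun x i => by
    fin_cases i
    exacts [inf_le_left.trans inf_le_left, inf_le_left.trans inf_le_right, inf_le_right]
  have hs_M : ∀ x, s x ≤ support (M x) := fun x => by
    have h : ∀ x y z : Fin 5, support x ⊓ support y ⊓ support z ≤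
      support (x ⊓ z ⊔ y ⊓ (x ⊔ z)) := by decide
    refine le_of_forall_hom_le fun q => ?_
    simpa only [s, M, map_support, map_inf, map_sup] using h (q (x 0)) (q (x 1)) (q (x 2))
  have hs_c : ∀ x, s x ≤ support c := fun x => (hs_le x 0).trans (hc _)
  have h_glue : ∀ x z, s x ≤ support z → s x ⊓ b ≤ z ∧ s x ⊓ z ≤ t := fun x z hz => by
    have h := glue_mem_coreBelow hb (hs_compl x) (hs_c x) hz
    refine ⟨?_, le_sup_left.trans (ht_ge _ h)⟩
    calc s x ⊓ b ≤ s x ⊓ (s x ⊓ z ⊔ star (s x) ⊓ b) := inf_le_inf_left _ (hb_le _ h)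
      _ = s x ⊓ z := by
        rw [inf_sup_left, ← inf_assoc, inf_idem, ← inf_assoc, inf_star_self, bot_inf_eq, sup_bot_eq]
      _ ≤ z := inf_le_right
  have h_ex : ∀ x, ∃ w, w ⊓ (s x ⊓ M x) = lo x ∧ w ⊔ (s x ⊓ M x) = hi x := fun x => by
    obtain ⟨y, hy, hy₁, hy₂⟩ := h_compl _ (glue_mem_coreBelow hb (hs_compl x) (hs_c x) (hs_M x))
    have h₁ : s x ⊓ (s x ⊓ M x ⊔ star (s x) ⊓ b) = s x ⊓ M x := by
      rw [inf_sup_left, ← inf_assoc, inf_idem, ← inf_assoc, inf_star_self, bot_inf_eq, sup_bot_eq]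
    refine ⟨_, relative_complement (y := y) (inf_le_inf_left _ le_sup_left)
      (inf_le_inf_left _ (sup_le (inf_le_left.trans le_sup_left) inf_le_right)) ?_ ?_⟩
    · calc s x ⊓ M x ⊓ y ≤ s x ⊓ ((s x ⊓ M x ⊔ star (s x) ⊓ b) ⊓ y) :=
          le_inf (inf_le_left.trans inf_le_left) (inf_le_inf_right _ le_sup_left)
        _ = s x ⊓ b := by rw [hy₁]
        _ ≤ _ := le_inf inf_le_left (le_inf (h_glue x _ (hs_le x 0)).1 (h_glue x _ (hs_le x 2)).1)
    · calc s x ⊓ (x 0 ⊔ x 2) ≤ s x ⊓ t := le_inf inf_le_left (by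
            rw [inf_sup_left]
            exact sup_le (h_glue x _ (hs_le x 0)).2 (h_glue x _ (hs_le x 2)).2)
        _ ≤ s x ⊓ M x ⊔ y := by
          rw [← hy₂, inf_sup_left, h₁]
          exact sup_le_sup_left inf_le_right _
  choose F hF using h_ex
  intro hL
  have h_map : ∀ (e : DSHom L L) x, s (fun i => e (x i)) = e (s x) ∧
      lo (fun i => e (x i)) = e (lo x) ∧ hi (fun i => e (x i)) = e (hi x) ∧
      M (fun i => e (x i)) = e (M x) := fun e x => by
    simp only [s, lo, hi, M, map_inf, map_sup, map_support, and_self]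
  obtain ⟨τ, hτ⟩ := hL F fun e x => by
    have h := hF fun i => e (x i)
    simp only [h_map] at h
    have h' := hF x
    refine eq_of_inf_eq_sup_eq (a := e (s x) ⊓ e (M x)) ?_ ?_
    · rw [h.1, ← (hF x).1, map_inf, map_inf]
    · rw [h.2, ← (hF x).2, map_sup, map_inf]
  have hbt_le : b ≤ t := hb_le t ht
  have hs_eq : ∀ x : Fin 3 → L, (∀ i, x i ∈ coreBelow (support c)) → s x = support c :=
      fun x hx => by
    simp only [s, (hx _).2, inf_idem]
  -- the operation is not monotone in its second argument
  have h₁ : F ![b, b, t] = t := by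
    have h := hF ![b, b, t]
    have h_s := hs_eq ![b, b, t] (by intro i; fin_cases i; exacts [hb, hb, ht])
    simp only [lo, hi, M, h_s] at h
    simp only [Matrix.cons_val, inf_eq_left.2 hbt_le, sup_eq_right.2 hbt_le, sup_idem,
      inf_eq_right.2 hb.1, inf_eq_right.2 ht.1] at h
    rw [sup_eq_left.2 (inf_eq_right.1 h.1)] at h
    exact h.2
  have h₂ : F ![b, t, t] = b := by
    have h := hF ![b, t, t]
    have h_s := hs_eq ![b, t, t] (by intro i; fin_cases i; exacts [hb, ht, ht])
    simp only [lo, hi, M, h_s] at h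
    simp only [Matrix.cons_val, inf_eq_left.2 hbt_le, sup_eq_right.2 hbt_le, inf_idem,
      inf_eq_right.2 hb.1, inf_eq_right.2 ht.1] at h
    rw [inf_eq_left.2 (sup_eq_right.1 h.2)] at h
    exact h.1
  obtain ⟨q, hq⟩ : ∃ q : DSHom L (Fin 5), q b ≠ q t := by
    by_contra! h
    exact hbt (eq_of_forall_hom_eq h)
  have h_bot_top : (q b = ⊥ ↔ q t = ⊥) ∧ (q b = ⊤ ↔ q t = ⊤) := by
    rcases mem_coreBelow_iff.1 hb q with h | h <;> rcases mem_coreBelow_iff.1 ht q with h' | h'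
    · tauto
    · exact absurd (h'.1.symm.trans h.1) (by decide)
    · exact absurd (h.1.symm.trans h'.1) (by decide)
    · rw [h.2, h'.2]; simp
  have h₃ := congrArg q (hτ ![b, b, t])
  have h₄ := congrArg q (hτ ![b, t, t])
  rw [h₁, map_eval] at h₃
  rw [h₂, map_eval] at h₄
  have h₅ : τ.eval (fun i => q (![b, b, t] i)) ≤ τ.eval (fun i => q (![b, t, t] i)) := by
    refine eval_mono τ (fun i => ?_) (fun i => ?_) (fun i => ?_) <;> fin_cases i
    exacts [le_rfl, map_mono q hbt_le, le_rfl, Iff.rfl, h_bot_top.1, Iff.rfl, Iff.rfl, h_bot_top.2,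
      Iff.rfl]
  rw [← h₃, ← h₄] at h₅
  exact hq (le_antisymm (map_mono q hbt_le) h₅)

/-- If `L` is the product of `𝟐` and a nontrivial algebra without homomorphisms to `𝟐`, then every
endomorphism leaves the component in `𝟐` unchanged, so that an operation may depend on it. -/
theorem not_kEndoprimal_of_atom {c : L} (hc : ∀ x, support x ≤ support c) (hc_bot : support c ≠ ⊥)
    (ha_bot : star (support c) ≠ ⊥) (ha : ∀ x ≤ star (support c), x = ⊥ ∨ x = star (support c))
    (k : ℕ) : ¬ KEndoprimal (k + 1) L := by
  classical
  let a := star (support c)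
  have h_iff : ∀ (e : DSHom L L) x, a ≤ e x ↔ a ≤ x := fun e x => by
    have h₁ : a ≤ e a := by
      rw [map_star, map_support, le_star_iff, inf_comm, ← le_bot_iff]
      refine (inf_le_inf_left a (hc (e c))).trans ?_
      rw [inf_comm, inf_star_self]
    refine ⟨fun h => ?_, fun h => h₁.trans (map_mono e h)⟩
    rcases ha (x ⊓ a) inf_le_right with h₂ | h₂
    · refine absurd (le_bot_iff.1 ?_) ha_bot
      calc a ≤ e x ⊓ e a := le_inf h h₁
        _ = ⊥ := by rw [← map_inf, h₂, map_bot]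
    · exact inf_eq_right.1 h₂
  intro hL
  obtain ⟨τ, hτ⟩ := hL (fun x => if a ≤ x 0 then x 0 ⊔ star (x 0) else x 0) fun e x => by
    simp only [h_iff]
    split_ifs
    · rw [map_sup, map_star]
    · rfl
  obtain ⟨q, hq⟩ : ∃ q : DSHom L (Fin 5), q (support c) ≠ ⊥ := by
    by_contra! h
    exact hc_bot (eq_of_forall_hom_eq fun q => by rw [h, map_bot])
  have hq' : q (support c) = ⊤ := by
    rw [map_support] at hq ⊢
    exact ((fin_support (n := 3) (q c)).resolve_right fun h => hq h.1).1
  have hqa : q a = ⊥ := by rw [map_star, hq', star_top]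
  have h₁ := congrArg q (hτ fun _ => ⊥)
  have h₂ := congrArg q (hτ fun _ => a)
  simp only [le_bot_iff, map_eval, map_bot, hqa, le_refl, if_true, star_sup_star_star, a] at h₁ h₂
  rw [if_neg ha_bot, map_bot] at h₁
  rw [map_top, ← h₁] at h₂
  exact absurd h₂ (by decide)

/-- If the core has exactly one element, this element is fixed by all endomorphisms, but it is not
the value of a constant term. -/
theorem not_kEndoprimal_of_core_subsingleton {c : L} (hc : c ∈ core L)
    (h_core : ∀ x ∈ core L, x = c) (h_ne : (⊥ : L) ≠ ⊤) (k : ℕ) : ¬ KEndoprimal k L := by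
  intro hL
  obtain ⟨τ, hτ⟩ := hL (fun _ => c) fun e _ => (h_core _ (map_mem_core e hc)).symm
  have h₁ : c = ⊥ ∨ c = ⊤ := by
    have h₂ := map_eval (twoHom L) (fun _ : Fin k => (⊥ : Fin 2)) τ
    rw [map_bot, ← hτ] at h₂
    rw [← h₂]
    change (if _ then ⊥ else ⊤) = ⊥ ∨ (if _ then ⊥ else ⊤) = ⊤
    split_ifs
    exacts [Or.inl rfl, Or.inr rfl]
  rcases h₁ with rfl | rfl
  · exact h_ne (hc.1.symm.trans star_bot)
  · exact h_ne (plus_top.symm.trans hc.2)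

end Negative

/-! ### Retracts -/

section Retracts

variable {L : Type u} [DoubleStoneAlgebra L]

/-- An element of the core without complement lies, together with the bounds of the core, in the
image of a retraction to the five-element chain: it separates two comparable prime filters. -/
theorem exists_hom_five_of_not_complemented [Finite L] {e b t a : L} (hb : b ∈ coreBelow e)
    (ht : t ∈ coreBelow e) (hb_le : ∀ x ∈ coreBelow e, b ≤ x) (ht_ge : ∀ x ∈ coreBelow e, x ≤ t)
    (ha : a ∈ coreBelow e) (h_compl : ∀ y ∈ coreBelow e, ¬ (a ⊓ y = b ∧ a ⊔ y = t)) :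
    ∃ q : DSHom L (Fin 5), q b = 1 ∧ q a = 2 ∧ q t = 3 := by
  -- the pseudocomplement of `a` in the core
  obtain ⟨a', ⟨ha', haa'⟩, h_max⟩ := exists_greatest_of_sup_mem
    (S := {y | y ∈ coreBelow e ∧ a ⊓ y = b}) ⟨b, hb, inf_eq_right.2 (hb_le a ha)⟩
    (fun x hx y hy => ⟨coreBelow_sup hx.1 hy.1, by rw [inf_sup_left, hx.2, hy.2, sup_idem]⟩)
  obtain ⟨P, hP, hPt, hPa⟩ : ∃ P : L → Prop, IsPrimePred P ∧ P t ∧ ¬ P (a ⊔ a') :=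
    exists_isPrimePred_of_not_le fun h => h_compl a' ha' ⟨haa',
      le_antisymm (ht_ge _ (coreBelow_sup ha ha')) h⟩
  rw [hP.sup, not_or] at hPa
  obtain ⟨Q, hQ, hPQ, hQa, hQb⟩ := exists_isPrimePred P hP.top
    (fun x y hx hy => (hP.inf x y).2 ⟨hx, hy⟩) a b (fun p hp h => by
      have h₁ : p ⊓ t ⊔ b ∈ coreBelow e := coreBelow_of_le_of_le hb ht le_sup_right
        (sup_le inf_le_right (hb_le t ht))
      have h₂ : a ⊓ (p ⊓ t ⊔ b) = b := by
        refine le_antisymm ?_ (le_inf (hb_le a ha) le_sup_right)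
        rw [inf_sup_left]
        exact sup_le ((le_inf (inf_le_right.trans inf_le_left) inf_le_left).trans h) inf_le_right
      exact hPa.2 (hP.mono (h_max _ ⟨h₁, h₂⟩)
        (hP.mono le_sup_left ((hP.inf p t).2 ⟨hp, hPt⟩))))
  obtain ⟨q, hq⟩ := exists_hom_five hP hQ hPQ
  have h_core : ∀ x ∈ coreBelow e, q x ≠ ⊥ ∧ q x ≠ ⊤ := fun x hx => by
    refine ((mem_coreBelow_iff.1 hx q).resolve_right fun h => ?_).2
    have h₁ := (hq t).2.2 hPt
    have h₂ := map_mono q ht.1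
    rw [h.1, le_bot_iff] at h₂
    rw [h₂] at h₁
    exact absurd h₁ (by decide)
  have h₁ : ∀ y : Fin 5, y ≠ ⊥ ∧ y ≠ ⊤ → (¬ 2 ≤ y → y = 1) ∧ (2 ≤ y → ¬ 3 ≤ y → y = 2) ∧
      (3 ≤ y → y = 3) := by decide
  refine ⟨q, (h₁ _ (h_core b hb)).1 ?_, (h₁ _ (h_core a ha)).2.1 ?_ ?_, (h₁ _ (h_core t ht)).2.2 ?_⟩
  · rwa [(hq b).1]
  · rwa [(hq a).1]
  · rw [(hq a).2]; exact hPa.1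
  · rwa [(hq t).2]

variable {n : ℕ}

theorem isRetractOf_of_chain {C : Fin (n + 2) → L} (h_mono : Monotone C) (h_bot : C ⊥ = ⊥)
    (h_top : C ⊤ = ⊤) (h_core : ∀ s, s ≠ ⊥ → s ≠ ⊤ → C s ∈ core L) (q : DSHom L (Fin (n + 2)))
    (hq : ∀ s, q (C s) = s) : IsRetractOf (Fin (n + 2)) L :=
  ⟨chainHom C h_mono h_bot h_top h_core, q, hq⟩

/-- A chain in the factor `[⊥, e]` and two elements splitting the Boolean factor `[⊥, star e]`
together generate a retract. -/
theorem isRetractOf_of_chain_of_split {c : L} (hc : ∀ x, support x ≤ support c)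
    {C : Fin (n + 2) → L} (h_mono : Monotone C) (h_bot : C ⊥ = ⊥) (h_top : C ⊤ = support c)
    (h_core : ∀ s, s ≠ ⊥ → s ≠ ⊤ → C s ∈ coreBelow (support c)) (q : DSHom L (Fin (n + 2)))
    (hq : ∀ s, q (C s) = s) {x₁ x₂ : L} (h_inf : x₁ ⊓ x₂ = ⊥) (h_sup : x₁ ⊔ x₂ = star (support c))
    (hx₁ : x₁ ≠ ⊥) (hx₂ : x₂ ≠ ⊥) : IsRetractOf (Fin (n + 2) × (Fin 2 × Fin 2)) L := by
  have h_hom : ∀ x y : L, x ⊓ y = ⊥ → x ≤ star (support c) → x ≠ ⊥ →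
      ∃ f : DSHom L (Fin 2), f x = ⊤ ∧ f y = ⊥ ∧ f (support c) = ⊥ := by
    intro x y hxy hx hx_bot
    obtain ⟨P, hP, hPx, -⟩ := exists_isPrimePred_of_not_le fun h => hx_bot (le_bot_iff.1 h)
    obtain ⟨f, hf⟩ := exists_hom_two hc hP (hP.mono hx hPx)
    have hfx : f x = ⊤ := (hf x).2 hPx
    have h₁ := map_mono f hx
    rw [hfx, map_star, top_le_iff] at h₁
    have h₂ := congrArg f hxy
    rw [map_inf, hfx, map_bot, top_inf_eq] at h₂
    have h₃ : ∀ y : Fin 2, star y = ⊤ → y = ⊥ := by decide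
    exact ⟨f, hfx, h₂, h₃ _ h₁⟩
  obtain ⟨f₁, h₁₁, h₁₂, h₁₃⟩ := h_hom x₁ x₂ h_inf (h_sup ▸ le_sup_left) hx₁
  obtain ⟨f₂, h₂₂, h₂₁, h₂₃⟩ := h_hom x₂ x₁ (inf_comm x₂ x₁ ▸ h_inf) (h_sup ▸ le_sup_right) hx₂
  have hC : ∀ s, C s ≤ support c := fun s => h_top ▸ h_mono le_top
  let i (y : Fin (n + 2) × (Fin 2 × Fin 2)) : L :=
    C y.1 ⊔ ((if y.2.1 = 0 then ⊥ else x₁) ⊔ (if y.2.2 = 0 then ⊥ else x₂))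
  have hi : ∀ g : DSHom L (Fin 5),
      ∃ k : DSHom (Fin (n + 2) × (Fin 2 × Fin 2)) (Fin 5), ∀ y, g (i y) = k y := by
    intro g
    have hg : g (support c) = ⊤ ∨ g (support c) = ⊥ := by
      rw [map_support]
      rcases fin_support (n := 3) (g c) with h | h
      exacts [Or.inl h.1, Or.inr h.1]
    have hg_sup := congrArg g h_sup
    have hg_inf := congrArg g h_inf
    rw [map_sup, map_star] at hg_sup
    rw [map_inf, map_bot] at hg_inf
    rcases hg with hg | hg
    · -- `g` factors through the projection to the chain
      rw [hg, star_top, sup_eq_bot_iff] at hg_sup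
      refine ⟨(chainHom (fun s => g (C s)) (fun s r h => map_mono g (h_mono h))
        (by rw [h_bot, map_bot]) (by rw [h_top, hg]) (fun s h₀ h₁ => fin_mem_core ?_ ?_)).comp
        (fstHom _ _), fun y => ?_⟩
      · exact ((mem_coreBelow_iff.1 (h_core s h₀ h₁) g).resolve_right fun h => by
          rw [hg] at h; exact absurd h.1 (by decide)).2.1
      · exact ((mem_coreBelow_iff.1 (h_core s h₀ h₁) g).resolve_right fun h => by
          rw [hg] at h; exact absurd h.1 (by decide)).2.2
      · have h₁ : ∀ z : Fin 2, g (if z = 0 then ⊥ else x₁) = ⊥ := fun z => by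
          split_ifs
          exacts [map_bot g, hg_sup.1]
        have h₂ : ∀ z : Fin 2, g (if z = 0 then ⊥ else x₂) = ⊥ := fun z => by
          split_ifs
          exacts [map_bot g, hg_sup.2]
        rw [map_sup, map_sup, h₁, h₂, sup_bot_eq, sup_bot_eq]
        rfl
    · -- `g` factors through one of the projections to the two-element algebra
      rw [hg, star_bot] at hg_sup
      have hgC : ∀ s, g (C s) = ⊥ := fun s => le_bot_iff.1 (hg ▸ map_mono g (hC s))
      have h_cases : ∀ x y : Fin 5, x ⊔ y = ⊤ → x ⊓ y = ⊥ → (x = ⊤ ∧ y = ⊥) ∨ (x = ⊥ ∧ y = ⊤) := by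
        decide
      rcases h_cases _ _ hg_sup hg_inf with h | h
      · refine ⟨(twoHom (Fin 5)).comp ((fstHom _ _).comp (sndHom _ _)), fun y => ?_⟩
        rw [map_sup, map_sup, hgC, bot_sup_eq]
        change _ = if y.2.1 = 0 then ⊥ else ⊤
        split_ifs <;> simp [map_bot, h]
      · refine ⟨(twoHom (Fin 5)).comp ((sndHom _ _).comp (sndHom _ _)), fun y => ?_⟩
        rw [map_sup, map_sup, hgC, bot_sup_eq]
        change _ = if y.2.2 = 0 then ⊥ else ⊤
        split_ifs <;> simp [map_bot, h]
  have hqC : q (support c) = ⊤ := h_top ▸ hq ⊤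
  have hqx := congrArg q h_sup
  rw [map_sup, map_star, hqC, star_top, sup_eq_bot_iff] at hqx
  have h₁C : ∀ s, f₁ (C s) = ⊥ := fun s => le_bot_iff.1 (h₁₃ ▸ map_mono f₁ (hC s))
  have h₂C : ∀ s, f₂ (C s) = ⊥ := fun s => le_bot_iff.1 (h₂₃ ▸ map_mono f₂ (hC s))
  have h_two : ∀ z : Fin 2, (if z = 0 then ⊥ else ⊤) = z := by decide
  refine ⟨homOfSeparated i hi, pairHom q (pairHom f₁ f₂), fun y => ?_⟩
  change (q (i y), f₁ (i y), f₂ (i y)) = y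
  refine Prod.ext ?_ (Prod.ext ?_ ?_)
  · simp only [i, map_sup, hq]
    split_ifs <;> simp [map_bot, hqx.1, hqx.2]
  · simp only [i, map_sup, h₁C]
    rw [apply_ite f₁, apply_ite f₁, map_bot, h₁₁, h₁₂, ite_self, sup_bot_eq, bot_sup_eq, h_two]
  · simp only [i, map_sup, h₂C]
    rw [apply_ite f₂, apply_ite f₂, map_bot, h₂₁, h₂₂, ite_self, bot_sup_eq, bot_sup_eq, h_two]

/-- The Boolean factor `[⊥, star (support c)]` splits unless it is trivial or `𝟐`. -/
theorem exists_split_of_kEndoprimal {c : L} (hc : ∀ x, support x ≤ support c)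
    (hc_bot : support c ≠ ⊥) (hc_top : support c ≠ ⊤) {k : ℕ} (hL : KEndoprimal (k + 1) L) :
    ∃ x₁ x₂ : L, x₁ ⊓ x₂ = ⊥ ∧ x₁ ⊔ x₂ = star (support c) ∧ x₁ ≠ ⊥ ∧ x₂ ≠ ⊥ := by
  by_contra! h
  refine not_kEndoprimal_of_atom hc hc_bot (fun ha => hc_top ?_) (fun x hx => ?_) k hL
  · have h₁ := (isCompl_support c).sup_eq_top
    rwa [ha, sup_bot_eq] at h₁
  · by_contra! hx'
    have h₁ : ∀ x c : Fin 5, support x ≤ support c → star (support c) ≤ x ⊔ star x := by decide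
    refine hx'.2 (le_antisymm hx ?_)
    have h₂ := h x (star x ⊓ star (support c)) (by rw [← inf_assoc, inf_star_self, bot_inf_eq])
      (by
        rw [sup_inf_left, sup_eq_right.2 hx, inf_eq_right]
        refine le_of_forall_hom_le fun q => ?_
        have h₂ := map_mono q (hc x)
        rw [map_support, map_support] at h₂
        simpa only [map_sup, map_star, map_support] using h₁ _ _ h₂) hx'.1
    have h₃ : star (support c) ≤ star (star x) := by
      rw [le_star_iff, h₂]
    refine le_of_forall_hom_le fun q => ?_
    have h₄ : ∀ x c : Fin 5, support x ≤ support c → star (support c) ≤ star (star x) →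
      star (support c) ≤ x := by decide
    have h₅ := map_mono q (hc x)
    have h₆ := map_mono q h₃
    simp only [map_star, map_support] at h₅ h₆ ⊢
    exact h₄ _ _ h₅ h₆

end Retracts

section Chains

variable {L : Type u} [DoubleStoneAlgebra L] [Finite L]

/-- If the core of the factor `[⊥, e]` is not Boolean, the five-element chain is a retract of this
factor. -/
theorem exists_chain_five {c b t : L} (hb : b ∈ coreBelow (support c))
    (ht : t ∈ coreBelow (support c))
    (hb_le : ∀ x ∈ coreBelow (support c), b ≤ x) (ht_ge : ∀ x ∈ coreBelow (support c), x ≤ t)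
    (h_compl : ¬ ∀ x ∈ coreBelow (support c), ∃ y ∈ coreBelow (support c),
      x ⊓ y = b ∧ x ⊔ y = t) : ∃ (C : Fin 5 → L) (q : DSHom L (Fin 5)), Monotone C ∧ C ⊥ = ⊥ ∧
      C ⊤ = support c ∧ (∀ s, s ≠ ⊥ → s ≠ ⊤ → C s ∈ coreBelow (support c)) ∧ ∀ s, q (C s) = s := by
  obtain ⟨a, ha, h_compl⟩ : ∃ a ∈ coreBelow (support c), ∀ y ∈ coreBelow (support c),
      ¬ (a ⊓ y = b ∧ a ⊔ y = t) := by
    by_contra h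
    push Not at h
    exact h_compl h
  obtain ⟨q, hqb, hqa, hqt⟩ := exists_hom_five_of_not_complemented hb ht hb_le ht_ge ha h_compl
  refine ⟨![⊥, b, a, t, support c], q, ?_, rfl, rfl, ?_, ?_⟩
  · refine Fin.monotone_iff_le_succ.2 fun s => ?_
    fin_cases s
    exacts [bot_le, hb_le a ha, ht_ge a ha, ht.1]
  · intro s h₀ h₁
    fin_cases s
    exacts [absurd rfl h₀, hb, ha, ht, absurd rfl h₁]
  · have h_top : q (support c) = ⊤ := by
      refine ((mem_coreBelow_iff.1 hb q).resolve_right fun h => ?_).1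
      exact absurd (hqb.symm.trans h.2) (by decide)
    intro s
    fin_cases s
    exacts [map_bot q, hqb, hqa, hqt, h_top]

theorem exists_bounds_coreBelow (c : L) : ∃ b ∈ coreBelow (support c), ∃ t ∈ coreBelow (support c),
    (∀ x ∈ coreBelow (support c), b ≤ x) ∧ ∀ x ∈ coreBelow (support c), x ≤ t := by
  obtain ⟨b, hb, hb_le⟩ := exists_least_of_inf_mem ⟨_, inf_mem_coreBelow c⟩
    fun x hx y hy => coreBelow_inf hx hy
  obtain ⟨t, ht, ht_ge⟩ := exists_greatest_of_sup_mem ⟨_, inf_mem_coreBelow c⟩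
    fun x hx y hy => coreBelow_sup hx hy
  exact ⟨b, hb, t, ht, hb_le, ht_ge⟩

/-- For non-regular `L`, relative complementation rules out that the core of the factor `[⊥, e]` is
Boolean. -/
theorem not_complemented_of_kEndoprimal {L : Type u} [DoubleStoneAlgebra L] {c b t : L}
    (hc : ∀ x, support x ≤ support c) (h_reg : ¬ IsRegular L) (hb : b ∈ coreBelow (support c))
    (ht : t ∈ coreBelow (support c))
    (hb_le : ∀ x ∈ coreBelow (support c), b ≤ x) (ht_ge : ∀ x ∈ coreBelow (support c), x ≤ t)
    (hL : KEndoprimal 3 L) : ¬ ∀ x ∈ coreBelow (support c), ∃ y ∈ coreBelow (support c),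
      x ⊓ y = b ∧ x ⊔ y = t := by
  intro h_compl
  refine not_kEndoprimal_three hc hb ht hb_le ht_ge h_compl ?_ hL
  rintro rfl
  exact h_reg (isRegular_of_coreBelow_subsingleton hc fun x hx y hy =>
    (le_antisymm (ht_ge x hx) (hb_le x hx)).trans (le_antisymm (hb_le y hy) (ht_ge y hy)))

/-- The three-element chain is a retract of the factor `[⊥, support c]` if that factor is not
trivial. -/
theorem exists_chain_three {L : Type u} [DoubleStoneAlgebra L] {c : L} (hc_bot : support c ≠ ⊥) :
    ∃ (C : Fin 3 → L) (q : DSHom L (Fin 3)), Monotone C ∧ C ⊥ = ⊥ ∧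
      C ⊤ = support c ∧ (∀ s, s ≠ ⊥ → s ≠ ⊤ → C s ∈ coreBelow (support c)) ∧ ∀ s, q (C s) = s := by
  obtain ⟨q, hq⟩ : ∃ q : DSHom L (Fin 5), q (support c) ≠ ⊥ := by
    by_contra! h
    exact hc_bot (eq_of_forall_hom_eq fun q => by rw [h, map_bot])
  have h₁ : ∀ y : Fin 5, support y ≠ ⊥ → collapseHom (support y ⊓ y) = 1 ∧
      collapseHom (support y) = 2 := by decide
  have hc := inf_mem_coreBelow c
  rw [map_support] at hq
  refine ⟨![⊥, support c ⊓ c, support c], collapseHom.comp q, ?_, rfl, rfl, ?_, ?_⟩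
  · refine Fin.monotone_iff_le_succ.2 fun s => ?_
    fin_cases s
    exacts [bot_le, inf_le_left]
  · intro s h₀ h₁
    fin_cases s
    exacts [absurd rfl h₀, hc, absurd rfl h₁]
  · intro s
    fin_cases s
    · exact map_bot (collapseHom.comp q)
    · change collapseHom (q (support c ⊓ c)) = 1
      rw [map_inf, map_support]
      exact (h₁ _ hq).1
    · change collapseHom (q (support c)) = 2
      rw [map_support]
      exact (h₁ _ hq).2

end Chains

/-! ### The equivalences -/

section Main

variable {L : Type u} [DoubleStoneAlgebra L]

theorem isBooleanLattice_core_iff {b t : L} (hb : b ∈ core L) (ht : t ∈ core L)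
    (hb_le : ∀ x ∈ core L, b ≤ x) (ht_ge : ∀ x ∈ core L, x ≤ t) :
    IsBooleanLattice (core L) ↔ ∀ x ∈ core L, ∃ y ∈ core L, x ⊓ y = b ∧ x ⊔ y = t := by
  constructor
  · rintro ⟨b', t', hb', ht', h⟩ x hx
    have h_b : (b' : L) = b := le_antisymm (hb' ⟨b, hb⟩) (hb_le _ b'.2)
    have h_t : (t' : L) = t := le_antisymm (ht_ge _ t'.2) (ht' ⟨t, ht⟩)
    obtain ⟨y, h₁, h₂⟩ := h ⟨x, hx⟩
    exact ⟨y, y.2, (congrArg Subtype.val h₁).trans h_b, (congrArg Subtype.val h₂).trans h_t⟩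
  · intro h
    refine ⟨⟨b, hb⟩, ⟨t, ht⟩, fun x => hb_le x x.2, fun x => ht_ge x x.2, fun x => ?_⟩
    obtain ⟨y, hy, h₁, h₂⟩ := h x x.2
    exact ⟨⟨y, hy⟩, Subtype.ext h₁, Subtype.ext h₂⟩

theorem support_eq_top_of_core_nonempty {c : L} (hc : ∀ x, support x ≤ support c)
    (h : (core L : Set L).Nonempty) : support c = ⊤ := by
  obtain ⟨x, hx⟩ := h
  rw [eq_top_iff, ← support_eq_top_iff.2 hx]
  exact hc x

theorem support_ne_top_of_core_eq_empty (c : L) (h : (core L : Set L) = ∅) : support c ≠ ⊤ :=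
  fun hc => by
    have : c ∈ (core L : Set L) := support_eq_top_iff.1 hc
    rwa [h] at this

/-- Unless `L` is trivial, `𝟐` is a retract of `L` that generates `ISP(L)`. -/
theorem IsBooleanLattice.endodualisable [Finite L] (hL : IsBooleanLattice L) :
    Endodualisable.{u, v} L := by
  by_cases h_ne : (⊥ : L) = ⊤
  · have h_eq : ∀ x y : L, x = y := fun x y =>
      have h₁ : ∀ z : L, z = ⊥ := fun z => le_bot_iff.1 (h_ne ▸ le_top)
      (h₁ x).trans (h₁ y).symm
    exact fun A _ hA φ _ => ⟨⊥, fun h => h_eq _ _, fun b _ => memISP_iff.1 hA b ⊥ fun _ => h_eq _ _⟩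
  have h_supp : ∀ x : L, support x = ⊥ := fun x => by
    obtain ⟨b, t, hb, ht, h⟩ := hL
    obtain ⟨y, h₁, h₂⟩ := h x
    rw [hb.eq_bot] at h₁
    rw [ht.eq_top] at h₂
    have h₃ : IsCompl x y := IsCompl.of_eq h₁ h₂
    rw [support, star_eq_of_isCompl h₃, plus_eq_of_isCompl h₃, inf_comm, inf_star_self]
  have h_hom : ∀ x y : L, ¬ x ≤ y → ∃ f : DSHom L (Fin 2), f x = ⊤ ∧ f y ≠ ⊤ := fun x y hxy => by
    obtain ⟨P, hP, hx, hy⟩ := exists_isPrimePred_of_not_le hxy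
    obtain ⟨f, hf⟩ := exists_hom_two (c := x) (fun z => by rw [h_supp, h_supp]) hP
      (by rw [h_supp, star_bot]; exact hP.top)
    exact ⟨f, (hf x).2 hx, fun h => hy ((hf y).1 h)⟩
  obtain ⟨p, -, -⟩ := h_hom ⊤ ⊥ fun h => h_ne (le_bot_iff.1 h).symm
  have h_le : ∀ x y : L, (∀ q : DSHom L (Fin 2), q x = q y) → x ≤ y := fun x y h => by
    by_contra hxy
    obtain ⟨f, hx, hy⟩ := h_hom x y hxy
    exact hy ((h f).symm.trans hx)
  refine endodualisable_of_isRetractOf (n := 0) (fun A _ ψ _ => compatible_two ψ)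
    (fun x y h => le_antisymm (h_le x y h) (h_le y x fun q => (h q).symm))
    ⟨twoHom L, p, fun x => ?_⟩
  have h_two : ∀ z : Fin 2, (if z = 0 then ⊥ else ⊤) = z := by decide
  change p (if x = 0 then ⊥ else ⊤) = x
  rw [apply_ite p, map_bot, map_top, h_two]

theorem Endodualisable.endoprimal [Finite L] (h : Endodualisable.{u, v} L) : Endoprimal L :=
  fun k _ => h.kEndoprimal k

/-- The equivalences for an algebra that is not regular and has nonempty core. -/
theorem tfae_of_core_nonempty [Finite L] (h_reg : ¬ IsRegular L)
    (h_core : (core L : Set L).Nonempty) :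
    [Endodualisable.{u, v} L, Endoprimal L, KEndoprimal 3 L, IsRetractOf (Fin 5) L,
      ¬ IsBooleanLattice (core L)].TFAE := by
  obtain ⟨c, hc⟩ := exists_support_le L
  have hc_top := support_eq_top_of_core_nonempty hc h_core
  obtain ⟨b, hb, t, ht, hb_le, ht_ge⟩ := exists_bounds_coreBelow c
  have h_bool := isBooleanLattice_core_iff (b := b) (t := t)
  simp only [← mem_coreBelow_top_iff, ← hc_top] at h_bool
  replace h_bool := h_bool hb ht hb_le ht_ge
  tfae_have 1 → 2 := Endodualisable.endoprimal
  tfae_have 2 → 3 := fun h => h 3 (by norm_num)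
  tfae_have 3 → 5 := fun h => by
    rw [h_bool]
    exact not_complemented_of_kEndoprimal hc h_reg hb ht hb_le ht_ge h
  tfae_have 5 → 4 := fun h => by
    rw [h_bool] at h
    obtain ⟨C, q, h_mono, h_bot, h_top, h_mem, hq⟩ := exists_chain_five hb ht hb_le ht_ge h
    rw [hc_top] at h_top h_mem
    exact isRetractOf_of_chain (n := 3) h_mono h_bot h_top
      (fun s h₀ h₁ => mem_coreBelow_top_iff.1 (h_mem s h₀ h₁)) q hq
  tfae_have 4 → 1 := fun h => endodualisable_of_isRetractOf (n := 3)
    (fun A _ ψ hψ => compatible_five ψ hψ) (fun x y => eq_of_forall_hom_eq) h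
  tfae_finish

/-- The equivalences for an algebra that is not regular and has empty core. -/
theorem tfae_of_core_eq_empty [Finite L] (h_reg : ¬ IsRegular L) (h_core : (core L : Set L) = ∅) :
    [Endodualisable.{u, v} L, Endoprimal L, KEndoprimal 3 L,
      IsRetractOf (Fin 5 × (Fin 2 × Fin 2)) L].TFAE := by
  obtain ⟨c, hc⟩ := exists_support_le L
  obtain ⟨b, hb, t, ht, hb_le, ht_ge⟩ := exists_bounds_coreBelow c
  tfae_have 1 → 2 := Endodualisable.endoprimal
  tfae_have 2 → 3 := fun h => h 3 (by norm_num)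
  tfae_have 3 → 4 := fun h => by
    obtain ⟨C, q, h_mono, h_bot, h_top, h_mem, hq⟩ := exists_chain_five hb ht hb_le ht_ge
      (not_complemented_of_kEndoprimal hc h_reg hb ht hb_le ht_ge h)
    have hc_bot : support c ≠ ⊥ := fun h₀ => by
      have h₁ := hq ⊤
      rw [h_top, h₀, map_bot] at h₁
      exact absurd h₁ (by decide)
    obtain ⟨x₁, x₂, h₁, h₂, h₃, h₄⟩ := exists_split_of_kEndoprimal hc hc_bot
      (support_ne_top_of_core_eq_empty c h_core) h
    exact isRetractOf_of_chain_of_split (n := 3) hc h_mono h_bot h_top h_mem q hq h₁ h₂ h₃ h₄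
  tfae_have 4 → 1 := fun h => endodualisable_of_isRetractOf_prod (n := 3)
    (fun A _ ψ hψ _ => compatible_five ψ hψ) (fun x y => eq_of_forall_hom_eq) h
  tfae_finish

/-- The equivalences for a regular algebra that is not Boolean. -/
theorem tfae_of_isRegular [Finite L] (h_reg : IsRegular L) (h_bool : ¬ IsBooleanLattice L) :
    [Endodualisable.{u, v} L, Endoprimal L, KEndoprimal 1 L,
      IsRetractOf (Fin 3 × (Fin 2 × Fin 2)) L].TFAE := by
  obtain ⟨c, hc⟩ := exists_support_le L
  have hc_bot : support c ≠ ⊥ := fun h => h_bool (isBooleanLattice_of_support_eq_bot fun x =>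
    le_bot_iff.1 (h ▸ hc x))
  tfae_have 1 → 2 := Endodualisable.endoprimal
  tfae_have 2 → 3 := fun h => h 1 le_rfl
  tfae_have 3 → 4 := fun h => by
    have hc_top : support c ≠ ⊤ := fun hc_top => by
      have hc_core := support_eq_top_iff.1 hc_top
      exact not_kEndoprimal_of_core_subsingleton hc_core
        (fun x hx => h_reg.eq_of_mem_core hx hc_core) (hc_top ▸ hc_bot.symm) 1 h
    obtain ⟨C, q, h_mono, h_bot, h_top, h_mem, hq⟩ := exists_chain_three hc_bot
    obtain ⟨x₁, x₂, h₁, h₂, h₃, h₄⟩ := exists_split_of_kEndoprimal hc hc_bot hc_top h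
    exact isRetractOf_of_chain_of_split (n := 1) hc h_mono h_bot h_top h_mem q hq h₁ h₂ h₃ h₄
  tfae_have 4 → 1 := fun h => endodualisable_of_isRetractOf_prod (n := 1)
    (fun A _ ψ _ hψ => compatible_three ψ hψ) (memISP_iff.1 h_reg) h
  tfae_finish

theorem endoprimal_iff_endodualisable [Finite L] : Endoprimal L ↔ Endodualisable.{u, v} L := by
  by_cases h_bool : IsBooleanLattice L
  · exact iff_of_true (h_bool.endodualisable.{u, v}).endoprimal h_bool.endodualisable
  by_cases h_reg : IsRegular L
  · exact (tfae_of_isRegular h_reg h_bool).out 1 0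
  rcases (core L : Set L).eq_empty_or_nonempty with h | h
  · exact (tfae_of_core_eq_empty h_reg h).out 1 0
  · exact (tfae_of_core_nonempty h_reg h).out 1 0

end Main

end DoubleStone

theorem mainTheorem6 (L : Type u) [DoubleStoneAlgebra L] [Finite L] :
    (DoubleStone.IsProper L → (DoubleStone.core L : Set L).Nonempty →
      [DoubleStone.Endodualisable.{u, v} L,
        DoubleStone.Endoprimal L,
        DoubleStone.KEndoprimal 3 L,
        DoubleStone.IsRetractOf (Fin 5) L,
        ¬ DoubleStone.IsBooleanLattice (DoubleStone.core L)].TFAE) ∧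
    (DoubleStone.IsProper L → (DoubleStone.core L : Set L) = ∅ →
      [DoubleStone.Endodualisable.{u, v} L,
        DoubleStone.Endoprimal L,
        DoubleStone.KEndoprimal 3 L,
        DoubleStone.IsRetractOf (Fin 5 × (Fin 2 × Fin 2)) L].TFAE) ∧
    (DoubleStone.IsRegular L → ¬ DoubleStone.IsBooleanLattice L →
      [DoubleStone.Endodualisable.{u, v} L,
        DoubleStone.Endoprimal L,
        DoubleStone.KEndoprimal 1 L,
        DoubleStone.IsRetractOf (Fin 3 × (Fin 2 × Fin 2)) L].TFAE) ∧
    (DoubleStone.Endoprimal L ↔ DoubleStone.Endodualisable.{u, v} L) :=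
  ⟨fun h => DoubleStone.tfae_of_core_nonempty h.2, fun h => DoubleStone.tfae_of_core_eq_empty h.2,
    DoubleStone.tfae_of_isRegular, DoubleStone.endoprimal_iff_endodualisable⟩
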